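/- Let $V$ be a Euclidean space of dimension $n$, let $\mathcal K(V)$ be the set of non-empty compact convex subsets of $V$, and let $0\le i\le n$. For $K_1,\dots,K_n\in\mathcal K(V)$ let $V(K_1,\dots,K_n)$ denote the mixed volume, normalized by $V(K,\dots,K)=\mathrm{vol}(K)$; that is, $n!\,V(K_1,\dots,K_n)$ is the coefficient of $\lambda_1\cdots\lambda_n$ in the polynomial $\mathrm{vol}(\lambda_1K_1+\dots+\lambda_nK_n)$ in $\lambda_1,\dots,\lambda_n\ge 0$. Write $K[m]$ for $K$ repeated $m$ times. Let $\mathcal G(V)$ be the space of finite complex linear combinations of functions $K\mapsto\mu(f(K)+A)$ on $\mathcal K(V)$, where $f:V\hookrightarrow V'$ is a linear imbedding into a finite dimensional real vector space, $A\in\mathcal K(V')$, and $\mu$ is a measure on $V'$ with a smooth density with respect to the Lebesgue measure. For $\phi(K)=\sum_p c_p\,\mu_p(f_p(K)+A_p)$ and $\psi(K)=\sum_q d_q\,\nu_q(g_q(K)+B_q)$ in $\mathcal G(V)$ their product is $$(\phi\cdot\psi)(K)=\sum_{p,q}c_pd_q\,(\mu_p\boxtimes\nu_q)\bigl((f_p\times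 g_q)(\Delta(K))+A_p\times\{0\}+\{0\}\times B_q\bigr),$$ where $\Delta:V\to V\times V$ is the diagonal imbedding and $\mu\boxtimes\nu$ is the product measure (this does not depend on the representations chosen). Fix $A_1,\dots,A_{n-i},B_1,\dots,B_i\in\mathcal K(V)$ and put $$\phi(K)=V(K[i],A_1,\dots,A_{n-i}),\qquad \psi(K)=V(K[n-i],B_1,\dots,B_i).$$ Then $\phi,\psi\in\mathcal G(V)$, and for all $K\in\mathcal K(V)$ $$(\phi\cdot\psi)(K)=\binom ni^{-1}V(A_1,\dots,A_{n-i},-B_1,\dots,-B_i)\,\mathrm{vol}(K).$$ -/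

import Mathlib

open scoped Pointwise ContDiff

noncomputable section

namespace AleskerProduct

/-- The mixed volume `V(K₁, …, K_n)` of convex bodies in a Euclidean space of dimension `n`, the
bodies being indexed by a finite type with `n` elements. It is given by the polarization formula
`n! V(K₁, …, K_n) = ∑_S (-1)^(n - |S|) vol(∑_{j ∈ S} K_j)`, the sum being over all subsets `S` of
the index set; thus `V` is the symmetric, Minkowski multilinear function with
`V(K, …, K) = vol(K)`, and `n! V(K₁, …, K_n)` is the coefficient of `t₁ ⋯ t_n` in the polynomial
`vol(t₁ K₁ + ⋯ + t_n K_n)`, `t_j ≥ 0`. -/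
def mixedVolume {V : Type*} [NormedAddCommGroup V] [InnerProductSpace ℝ V]
    [FiniteDimensional ℝ V] [MeasurableSpace V] [BorelSpace V]
    {ι : Type*} [Fintype ι] (K : ι → ConvexBody V) : ℝ :=
  ((Fintype.card ι).factorial : ℝ)⁻¹ *
    ∑ S : Finset ι, (-1 : ℝ) ^ (Fintype.card ι - S.card) *
      MeasureTheory.volume.real ((∑ j ∈ S, K j : ConvexBody V) : Set V)

/-- The mixed volume is the one of Minkowski's theorem: if `vol(∑ t_j K_j)` is a polynomial in
`t_j ≥ 0`, then `n! V(K₁, …, K_n)` is its coefficient at `t₁ ⋯ t_n`. -/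
theorem factorial_mul_mixedVolume_eq_coeff {V : Type*} [NormedAddCommGroup V]
    [InnerProductSpace ℝ V] [FiniteDimensional ℝ V] [MeasurableSpace V] [BorelSpace V]
    {ι : Type*} [Fintype ι] (hι : Fintype.card ι = Module.finrank ℝ V) (K : ι → ConvexBody V)
    (P : MvPolynomial ι ℝ)
    (hP : ∀ t : ι → ℝ, (∀ j, 0 ≤ t j) →
      MeasureTheory.volume.real ((∑ j, t j • K j : ConvexBody V) : Set V) = P.eval t) :
    ((Fintype.card ι).factorial : ℝ) * mixedVolume K =
      P.coeff (Finsupp.equivFunOnFinite.symm fun _ => 1) := by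
  classical
  have hvol : ∀ (S : Finset ι) (t : ℝ), 0 ≤ t →
      P.eval (fun j => if j ∈ S then t else 0) = t ^ Fintype.card ι *
        MeasureTheory.volume.real ((∑ j ∈ S, K j : ConvexBody V) : Set V) := by
    intro S t ht
    rw [← hP _ (fun j => by split_ifs <;> simp [ht])]
    have : (∑ j, (if j ∈ S then t else 0) • K j : ConvexBody V) = t • ∑ j ∈ S, K j := by
      rw [Finset.smul_sum, ← Finset.sum_subset (Finset.subset_univ S)]
      · exact Finset.sum_congr rfl fun j hj => by rw [if_pos hj]
      · intro j _ hj
        rw [if_neg hj]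
        exact SetLike.ext' (Set.zero_smul_set (K j).nonempty)
    rw [this, ConvexBody.coe_smul, MeasureTheory.measureReal_def,
      MeasureTheory.Measure.addHaar_smul, ENNReal.toReal_mul, ENNReal.toReal_ofReal (abs_nonneg _),
      abs_of_nonneg (pow_nonneg ht _), hι, MeasureTheory.measureReal_def]
  let Q : Polynomial ℝ := ∑ m ∈ P.support, Polynomial.C (P.coeff m) *
    ∏ j, (Polynomial.X ^ m j + -Polynomial.C (0 ^ m j))
  have hQ : Q = Polynomial.C (((Fintype.card ι).factorial : ℝ) * mixedVolume K) *
      Polynomial.X ^ Fintype.card ι := by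
    refine Polynomial.eq_of_infinite_eval_eq _ _ ((Set.Ici_infinite (0 : ℝ)).mono ?_)
    intro t ht
    have hexp : ∀ m : ι →₀ ℕ, ∏ j, (t ^ m j + -(0 : ℝ) ^ m j) = ∑ S : Finset ι,
        (-1 : ℝ) ^ (Fintype.card ι - S.card) * ∏ j, (if j ∈ S then t else 0) ^ m j := by
      intro m
      rw [Finset.prod_add, Finset.powerset_univ]
      refine Finset.sum_congr rfl fun S _ => ?_
      rw [Finset.prod_neg, ← Finset.prod_mul_prod_compl S, Finset.card_univ_sdiff]
      rw [Finset.prod_congr rfl (g := fun j => t ^ m j) (s₁ := S) (s₂ := S)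
        (f := fun j => (if j ∈ S then t else 0) ^ m j) fun j hj => by rw [if_pos hj]]
      rw [Finset.prod_congr rfl (g := fun j => (0 : ℝ) ^ m j) (s₁ := Sᶜ) (s₂ := Sᶜ)
        (f := fun j => (if j ∈ S then t else 0) ^ m j)
        fun j hj => by rw [if_neg (Finset.mem_compl.1 hj)]]
      rw [Finset.compl_eq_univ_sdiff]
      ring
    have hfac : ((Fintype.card ι).factorial : ℝ) ≠ 0 := by positivity
    change Q.eval t = _
    simp only [Q, Polynomial.eval_finsetSum, Polynomial.eval_mul, Polynomial.eval_C,
      Polynomial.eval_prod, Polynomial.eval_add, Polynomial.eval_neg, Polynomial.eval_pow,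
      Polynomial.eval_X, hexp, Finset.mul_sum]
    rw [Finset.sum_comm, mixedVolume, mul_inv_cancel_left₀ hfac, Finset.sum_mul]
    refine Finset.sum_congr rfl fun S _ => ?_
    rw [mul_assoc, mul_comm (MeasureTheory.volume.real _), ← hvol S t ht, MvPolynomial.eval_eq',
      Finset.mul_sum]
    exact Finset.sum_congr rfl fun m _ => by ring
  have hc := congrArg (fun R => Polynomial.coeff R (Fintype.card ι)) hQ
  simp only [Q, Polynomial.finsetSum_coeff, Polynomial.coeff_C_mul, Polynomial.coeff_X_pow,
    if_true, mul_one] at hc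
  rw [← hc]
  set e : ι →₀ ℕ := Finsupp.equivFunOnFinite.symm fun _ => 1 with he
  have hterm : ∀ m : ι →₀ ℕ, (∏ j, (Polynomial.X ^ m j + -Polynomial.C ((0 : ℝ) ^ m j))).coeff
      (Fintype.card ι) = if m = e then 1 else 0 := by
    intro m
    by_cases h0 : ∃ j, m j = 0
    · obtain ⟨j, hj⟩ := h0
      rw [Finset.prod_eq_zero (Finset.mem_univ j) (by simp [hj]), if_neg]
      · simp
      · rintro rfl
        simp [he] at hj
    · push Not at h0
      have : ∏ j, (Polynomial.X ^ m j + -Polynomial.C ((0 : ℝ) ^ m j)) =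
          (Polynomial.X : Polynomial ℝ) ^ ∑ j, m j := by
        rw [← Finset.prod_pow_eq_pow_sum]
        exact Finset.prod_congr rfl fun j _ => by simp [zero_pow (h0 j)]
      rw [this, Polynomial.coeff_X_pow]
      congr 1
      rw [eq_iff_iff]
      constructor
      · intro h
        have h1 : ∑ _j : ι, 1 = ∑ j, m j := by simpa using h
        rw [Finset.sum_eq_sum_iff_of_le fun j _ => Nat.one_le_iff_ne_zero.2 (h0 j)] at h1
        ext j
        simpa [he] using (h1 j (Finset.mem_univ j)).symm
      · rintro rfl
        simp [he]
  simp only [hterm, mul_ite, mul_one, mul_zero, Finset.sum_ite_eq']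
  split_ifs with h
  · rfl
  · exact (MvPolynomial.notMem_support_iff.1 h).symm

/-- The data `(V', f, A, μ)` of a valuation `K ↦ μ(f(K) + A)` on `V`: a linear imbedding `f` of `V`
into a finite dimensional space `V'` (without loss of generality some `ℝ^m`), a convex body `A`
in `V'`, and a smooth measure `μ` on `V'`, that is, a measure with a smooth (complex valued)
density with respect to the Lebesgue measure. -/
structure Generator (V : Type*) [NormedAddCommGroup V] [NormedSpace ℝ V] where
  dim : ℕ
  emb : V →ₗ[ℝ] EuclideanSpace ℝ (Fin dim)
  emb_injective : Function.Injective emb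
  body : ConvexBody (EuclideanSpace ℝ (Fin dim))
  density : EuclideanSpace ℝ (Fin dim) → ℂ
  density_smooth : ContDiff ℝ ∞ density

/-- The valuation `K ↦ μ(f(K) + A)`. -/
def Generator.toValuation {V : Type*} [NormedAddCommGroup V] [NormedSpace ℝ V]
    (a : Generator V) (K : ConvexBody V) : ℂ :=
  ∫ x in a.emb '' (K : Set V) + (a.body : Set _), a.density x

/-- The finite linear combination `∑ c_a φ_a` of valuations `φ_a(K) = μ_a(f_a(K) + A_a)`. -/
def combination {V : Type*} [NormedAddCommGroup V] [NormedSpace ℝ V]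
    (c : Generator V →₀ ℂ) (K : ConvexBody V) : ℂ :=
  c.sum fun a s => s * a.toValuation K

/-- The space `𝒢(V)` of all finite linear combinations of valuations `K ↦ μ(f(K) + A)`. -/
def GVal (V : Type*) [NormedAddCommGroup V] [NormedSpace ℝ V] : Set (ConvexBody V → ℂ) :=
  Set.range combination

/-- The exterior product of the valuations `K ↦ μ(f(K) + A)` on `V` and `L ↦ ν(g(L) + B)` on `W`:
the valuation `M ↦ (μ ⊠ ν)((f × g)(M) + (A × {0}) + ({0} × B))` on `V × W`. -/
def Generator.exterior {V W : Type*} [NormedAddCommGroup V] [NormedSpace ℝ V]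
    [NormedAddCommGroup W] [NormedSpace ℝ W]
    (a : Generator V) (b : Generator W) (M : ConvexBody (V × W)) : ℂ :=
  ∫ p in Prod.map a.emb b.emb '' (M : Set (V × W)) +
      (a.body : Set (EuclideanSpace ℝ (Fin a.dim))) ×ˢ {0} +
      {0} ×ˢ (b.body : Set (EuclideanSpace ℝ (Fin b.dim))),
    a.density p.1 * b.density p.2 ∂(MeasureTheory.volume.prod MeasureTheory.volume)

/-- The exterior product of two linear combinations, by bilinearity. -/
def combinationExterior {V W : Type*} [NormedAddCommGroup V] [NormedSpace ℝ V]
    [NormedAddCommGroup W] [NormedSpace ℝ W]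
    (c : Generator V →₀ ℂ) (d : Generator W →₀ ℂ) (M : ConvexBody (V × W)) : ℂ :=
  c.sum fun a s => d.sum fun b t => s * t * a.exterior b M

/-- The exterior product `φ ⊠ ψ` of `φ ∈ 𝒢(V)` and `ψ ∈ 𝒢(W)`. It is computed from any
representations of `φ` and `ψ` as linear combinations: see `exteriorProduct_eq`. -/
def exteriorProduct {V W : Type*} [NormedAddCommGroup V] [NormedSpace ℝ V]
    [NormedAddCommGroup W] [NormedSpace ℝ W]
    (φ : GVal V) (ψ : GVal W) : ConvexBody (V × W) → ℂ :=
  combinationExterior φ.2.choose ψ.2.choose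

/-- The image of a convex body in `V` under the diagonal imbedding `Δ : V → V × V`. -/
def diagonal {V : Type*} [NormedAddCommGroup V] [NormedSpace ℝ V]
    (K : ConvexBody V) : ConvexBody (V × V) where
  carrier := (fun x => (x, x)) '' (K : Set V)
  convex' := K.convex.is_linear_image (f := fun x : V => (x, x))
    ⟨fun _ _ => rfl, fun _ _ => rfl⟩
  isCompact' := K.isCompact.image (continuous_id.prodMk continuous_id)
  nonempty' := K.nonempty.image _

/-- The product `φ · ψ = Δ^*(φ ⊠ ψ)` of two valuations in `𝒢(V)`. -/
def product {V : Type*} [NormedAddCommGroup V] [NormedSpace ℝ V]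
    (φ ψ : GVal V) (K : ConvexBody V) : ℂ :=
  exteriorProduct φ ψ (diagonal K)

section WellDefined

variable {V W : Type*} [NormedAddCommGroup V] [NormedSpace ℝ V]
  [NormedAddCommGroup W] [NormedSpace ℝ W]

/-- The domain of integration in the exterior product. -/
def Generator.region (a : Generator V) (b : Generator W) (M : Set (V × W)) :
    Set (EuclideanSpace ℝ (Fin a.dim) × EuclideanSpace ℝ (Fin b.dim)) :=
  Prod.map a.emb b.emb '' M +
      (a.body : Set (EuclideanSpace ℝ (Fin a.dim))) ×ˢ {0} +
      {0} ×ˢ (b.body : Set (EuclideanSpace ℝ (Fin b.dim)))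

theorem Generator.mem_region (a : Generator V) (b : Generator W) (M : Set (V × W))
    (x : EuclideanSpace ℝ (Fin a.dim)) (y : EuclideanSpace ℝ (Fin b.dim)) :
    (x, y) ∈ a.region b M ↔
      ∃ v w, (v, w) ∈ M ∧ x - a.emb v ∈ a.body ∧ y - b.emb w ∈ b.body := by
  constructor
  · rintro ⟨_, ⟨_, ⟨⟨v, w⟩, hm, rfl⟩, ⟨s, s'⟩, ⟨hs, hs'⟩, rfl⟩, ⟨t', t⟩, ⟨ht', ht⟩, h⟩
    simp only [Set.mem_singleton_iff] at hs' ht'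
    subst hs' ht'
    simp only [Prod.map_apply, Prod.mk_add_mk, add_zero, Prod.mk.injEq] at h
    obtain ⟨rfl, rfl⟩ := h
    exact ⟨v, w, hm, by simpa using hs, by simpa using ht⟩
  · rintro ⟨v, w, hm, hs, ht⟩
    refine ⟨_, ⟨_, ⟨(v, w), hm, rfl⟩, (x - a.emb v, 0), ⟨hs, rfl⟩, rfl⟩,
      (0, y - b.emb w), ⟨rfl, ht⟩, ?_⟩
    simp

theorem Generator.continuous_emb (a : Generator V) : Continuous a.emb := by
  have : FiniteDimensional ℝ V := FiniteDimensional.of_injective a.emb a.emb_injective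
  exact a.emb.continuous_of_finiteDimensional

theorem Generator.isCompact_region (a : Generator V) (b : Generator W) (M : ConvexBody (V × W)) :
    IsCompact (a.region b (M : Set (V × W))) :=
  ((M.isCompact.image (a.continuous_emb.prodMap b.continuous_emb)).add
    (a.body.isCompact.prod isCompact_singleton)).add
      (isCompact_singleton.prod b.body.isCompact)

/-- The slices of a convex body in `V × W` that occur in Fubini's formula. -/
def Generator.slice (a : Generator V) (M : Set (V × W)) (x : EuclideanSpace ℝ (Fin a.dim)) :
    Set W :=
  Prod.snd '' (M ∩ {p | x - a.emb p.1 ∈ a.body})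

theorem Generator.exterior_eq_integral (a : Generator V) (b : Generator W)
    (M : ConvexBody (V × W)) :
    MeasureTheory.Integrable (fun x => a.density x *
      ∫ y in b.emb '' a.slice (M : Set (V × W)) x + (b.body : Set _), b.density y) ∧
    a.exterior b M = ∫ x, a.density x *
      ∫ y in b.emb '' a.slice (M : Set (V × W)) x + (b.body : Set _), b.density y := by
  have hT := a.isCompact_region b M
  have hTm : MeasurableSet (a.region b (M : Set (V × W))) := hT.isClosed.measurableSet
  have hF : Continuous (fun p : EuclideanSpace ℝ (Fin a.dim) × EuclideanSpace ℝ (Fin b.dim) =>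
      a.density p.1 * b.density p.2) :=
    (a.density_smooth.continuous.comp continuous_fst).mul
      (b.density_smooth.continuous.comp continuous_snd)
  have hint := (hF.continuousOn (s := a.region b (M : Set (V × W)))).integrableOn_compact
    (μ := MeasureTheory.volume.prod MeasureTheory.volume) hT
  rw [← MeasureTheory.integrable_indicator_iff hTm] at hint
  have key : ∀ x, (∫ y, (a.region b (M : Set (V × W))).indicator
      (fun p => a.density p.1 * b.density p.2) (x, y)) = a.density x *
      ∫ y in b.emb '' a.slice (M : Set (V × W)) x + (b.body : Set _), b.density y := by
    intro x
    have hs : b.emb '' a.slice (M : Set (V × W)) x + (b.body : Set _) =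
        (fun y => (x, y)) ⁻¹' a.region b (M : Set (V × W)) := by
      ext y
      rw [Set.mem_preimage, a.mem_region]
      constructor
      · rintro ⟨_, ⟨w, ⟨⟨v, w⟩, ⟨hm, hv⟩, rfl⟩, rfl⟩, t, ht, rfl⟩
        exact ⟨v, w, hm, hv, by simpa using ht⟩
      · rintro ⟨v, w, hm, hv, hw⟩
        exact ⟨_, ⟨w, ⟨(v, w), ⟨hm, hv⟩, rfl⟩, rfl⟩, _, hw, by simp⟩
    rw [hs, ← MeasureTheory.integral_const_mul, ← MeasureTheory.integral_indicator
      (hTm.preimage measurable_prodMk_left)]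
    rfl
  constructor
  · simpa only [key] using hint.integral_prod_left
  · change ∫ p in a.region b (M : Set (V × W)), _ ∂_ = _
    rw [← MeasureTheory.integral_indicator hTm, MeasureTheory.integral_prod _ hint]
    simp only [key]

/-- If `∑ t_b ψ_b` only depends on the valuation, then so does its exterior product with a fixed
generator. -/
theorem Generator.exterior_congr (a : Generator V) {d d' : Generator W →₀ ℂ}
    (h : combination d = combination d') (M : ConvexBody (V × W)) :
    (d.sum fun b t => t * a.exterior b M) = d'.sum fun b t => t * a.exterior b M := by
  have formula : ∀ e : Generator W →₀ ℂ, (e.sum fun b t => t * a.exterior b M) =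
      ∫ x, a.density x * e.sum fun b t => t *
        ∫ y in b.emb '' a.slice (M : Set (V × W)) x + (b.body : Set _), b.density y := by
    intro e
    simp only [Finsupp.sum, Finset.mul_sum]
    rw [MeasureTheory.integral_finsetSum]
    · refine Finset.sum_congr rfl fun b _ => ?_
      rw [(a.exterior_eq_integral b M).2, ← MeasureTheory.integral_const_mul]
      congr 1
      ext x
      ring
    · intro b _
      refine ((a.exterior_eq_integral b M).1.const_mul (e b)).congr (.of_forall fun x => ?_)
      ring
  rw [formula, formula]
  congr 1
  ext x
  congr 1
  rcases (a.slice (M : Set (V × W)) x).eq_empty_or_nonempty with h0 | hne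
  · simp [h0]
  · let S : ConvexBody W :=
      { carrier := a.slice (M : Set (V × W)) x
        convex' := by
          refine (M.convex.inter ?_).is_linear_image ⟨fun _ _ => rfl, fun _ _ => rfl⟩
          intro p hp q hq s t hs ht hst
          have := a.body.convex hp hq hs ht hst
          simp only [Set.mem_ofPred_eq, Prod.fst_add, Prod.smul_fst, map_add, map_smul]
          rw [show x - (s • a.emb p.1 + t • a.emb q.1) =
            s • (x - a.emb p.1) + t • (x - a.emb q.1) from ?_]
          · exact this
          rw [smul_sub, smul_sub, sub_add_sub_comm, ← add_smul, hst, one_smul]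
        isCompact' := (M.isCompact.inter_right (a.body.isClosed.preimage
          (continuous_const.sub (a.continuous_emb.comp continuous_fst)))).image continuous_snd
        nonempty' := hne }
    exact congrFun h S

/-- The image of a convex body under the exchange of the two factors. -/
def swapBody (M : ConvexBody (V × W)) : ConvexBody (W × V) where
  carrier := Prod.swap '' (M : Set (V × W))
  convex' := M.convex.is_linear_image ⟨fun _ _ => rfl, fun _ _ => rfl⟩
  isCompact' := M.isCompact.image continuous_swap
  nonempty' := M.nonempty.image _

theorem Generator.exterior_swap (a : Generator V) (b : Generator W) (M : ConvexBody (V × W)) :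
    a.exterior b M = b.exterior a (swapBody M) := by
  change ∫ p in a.region b (M : Set (V × W)), _ ∂_ =
    ∫ p in b.region a (swapBody M : Set (W × V)), _ ∂_
  rw [← MeasureTheory.integral_indicator (a.isCompact_region b M).isClosed.measurableSet,
    ← MeasureTheory.integral_indicator (b.isCompact_region a _).isClosed.measurableSet,
    ← MeasureTheory.integral_prod_swap]
  congr 1
  ext ⟨y, x⟩
  have : (x, y) ∈ a.region b (M : Set (V × W)) ↔
      (y, x) ∈ b.region a (swapBody M : Set (W × V)) := by
    rw [Generator.mem_region, Generator.mem_region]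
    constructor
    · rintro ⟨v, w, hm, hv, hw⟩
      exact ⟨w, v, ⟨(v, w), hm, rfl⟩, hw, hv⟩
    · rintro ⟨w, v, ⟨⟨v', w'⟩, hm, h⟩, hw, hv⟩
      cases h
      exact ⟨_, _, hm, hv, hw⟩
  by_cases hx : (x, y) ∈ a.region b (M : Set (V × W))
  · simp only [Prod.swap_prod_mk, Set.indicator_of_mem hx, Set.indicator_of_mem (this.1 hx)]
    ring
  · simp only [Prod.swap_prod_mk, Set.indicator_of_notMem hx,
      Set.indicator_of_notMem (mt this.2 hx)]

theorem combinationExterior_swap (c : Generator V →₀ ℂ) (d : Generator W →₀ ℂ)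
    (M : ConvexBody (V × W)) :
    combinationExterior c d M = combinationExterior d c (swapBody M) := by
  simp only [combinationExterior, Finsupp.sum]
  rw [Finset.sum_comm]
  refine Finset.sum_congr rfl fun b _ => Finset.sum_congr rfl fun a _ => ?_
  rw [a.exterior_swap b, mul_comm (c a)]

theorem combinationExterior_congr_right (c : Generator V →₀ ℂ) {d d' : Generator W →₀ ℂ}
    (h : combination d = combination d') (M : ConvexBody (V × W)) :
    combinationExterior c d M = combinationExterior c d' M := by
  refine Finset.sum_congr rfl fun a _ => ?_
  have := congrArg (c a * ·) (a.exterior_congr h M)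
  simpa only [Finsupp.sum, Finset.mul_sum, mul_assoc] using this

/-- The exterior product does not depend on the representations of the two factors. -/
theorem exteriorProduct_eq (φ : GVal V) (ψ : GVal W) (c : Generator V →₀ ℂ)
    (d : Generator W →₀ ℂ) (hc : combination c = φ) (hd : combination d = ψ) :
    exteriorProduct φ ψ = combinationExterior c d := by
  ext M
  rw [exteriorProduct, combinationExterior_congr_right _ (ψ.2.choose_spec.trans hd.symm),
    combinationExterior_swap, combinationExterior_congr_right _ (φ.2.choose_spec.trans hc.symm),
    ← combinationExterior_swap]

end WellDefined

end AleskerProduct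

end

/-! The product formula reduces to comparing one coefficient of two volume polynomials. By
Minkowski's theorem (`exists_polynomial_add`), vol(K + ∑ λ_j A_j) is a polynomial in λ ≥ 0, and
V(K[i], A_1, …) is i!/n! times its squarefree coefficient (`factorial_mul_mixedVolume_eq`).
Interpolation at integer points writes this coefficient as a fixed linear combination, independent
of K, of the values vol(K + ∑ k_j A_j). This puts φ and ψ in 𝒢(V) with explicit representations.

The exterior product of two such volume valuations, restricted to the diagonal, is the
2n-dimensional volume of Δ(K) + A × {0} + {0} × B. The interpolation weights are products over the
variables, so φ · ψ is i!(n-i)!/(n!)² times the squarefree coefficient of that volume, viewed as a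
polynomial in all n parameters. Its part of degree n is found by a shear taking (x, y) to (x - y,
y): the body becomes {(a - b, k + b)}, which lies in (A - B) × (K + B) and whose fibre over each
point of A - B contains a translate of K. When A and B are scaled by s → 0, the volume is therefore
s^n vol(K) vol(A - B) to leading order (`tendsto_diagonalSum`). Hence the coefficient is vol(K) n!
V(A, -B) (`coeff_ones_diagonalSum`), and i!(n-i)!/n! is the inverse binomial coefficient.

Minkowski's theorem is proved analytically: vol(K) is the integral of the Hessian determinant of a
mollified support function (`IsPotential.integral_det`), these potentials add under Minkowski sums,
and the determinant of a linear combination of Hessians is a homogeneous polynomial at each point.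
-/

noncomputable section

namespace AleskerProduct

open MeasureTheory Set Filter Topology
open scoped RealInnerProductSpace

/-! ### Convex potentials and volume as an integral of Hessian determinants -/

section Potential

variable {E : Type*} [NormedAddCommGroup E] [InnerProductSpace ℝ E]

/-- A smooth convex function `u` on `E` with gradient `g`, whose gradient takes values in `K`, and
which exceeds the support function of `K` up to a constant. -/
structure IsPotential (K : ConvexBody E) (u : E → ℝ) (g : E → E) : Prop where
  hasFDerivAt : ∀ x, HasFDerivAt u (innerSL ℝ (g x)) x
  contDiff : ContDiff ℝ 1 g
  subgradient : ∀ x y, u x + ⟪g x, y - x⟫ ≤ u y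
  mem : ∀ x, g x ∈ K
  lower : ∃ C, ∀ x, ∀ y ∈ K, ⟪y, x⟫ - C ≤ u x

theorem IsPotential.zero : IsPotential (0 : ConvexBody E) (fun _ => 0) (fun _ => 0) where
  hasFDerivAt x := by simpa using hasFDerivAt_const (0 : ℝ) x
  contDiff := contDiff_const
  subgradient x y := by simp
  mem x := Set.mem_zero.2 rfl
  lower := ⟨0, fun x y hy => by
    have : y = 0 := hy
    simp [this]⟩

theorem IsPotential.add {K L : ConvexBody E} {u v : E → ℝ} {g h : E → E}
    (hu : IsPotential K u g) (hv : IsPotential L v h) :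
    IsPotential (K + L) (fun x => u x + v x) (fun x => g x + h x) where
  hasFDerivAt x := by
    rw [map_add]
    exact (hu.hasFDerivAt x).add (hv.hasFDerivAt x)
  contDiff := hu.contDiff.add hv.contDiff
  subgradient x y := by
    have h1 := hu.subgradient x y
    have h2 := hv.subgradient x y
    rw [inner_add_left]
    linarith
  mem x := Set.add_mem_add (hu.mem x) (hv.mem x)
  lower := by
    obtain ⟨C, hC⟩ := hu.lower
    obtain ⟨D, hD⟩ := hv.lower
    refine ⟨C + D, ?_⟩
    rintro x _ ⟨a, ha, b, hb, rfl⟩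
    have h1 := hC x a ha
    have h2 := hD x b hb
    simp only [inner_add_left]
    linarith

theorem IsPotential.smul {K : ConvexBody E} {u : E → ℝ} {g : E → E}
    (hu : IsPotential K u g) {t : ℝ} (ht : 0 ≤ t) :
    IsPotential (t • K) (fun x => t * u x) (fun x => t • g x) where
  hasFDerivAt x := by simpa using (hu.hasFDerivAt x).const_mul t
  contDiff := hu.contDiff.const_smul t
  subgradient x y := by
    have h1 := mul_le_mul_of_nonneg_left (hu.subgradient x y) ht
    rw [real_inner_smul_left]
    linarith
  mem x := Set.smul_mem_smul_set (hu.mem x)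
  lower := by
    obtain ⟨C, hC⟩ := hu.lower
    refine ⟨t * C, ?_⟩
    rintro x _ ⟨a, ha, rfl⟩
    have h1 := mul_le_mul_of_nonneg_left (hC x a ha) ht
    simp only [real_inner_smul_left]
    linarith

theorem IsPotential.sum {ι : Type*} (s : Finset ι) {K : ι → ConvexBody E} {u : ι → E → ℝ}
    {g : ι → E → E} (hu : ∀ j, IsPotential (K j) (u j) (g j)) {t : ι → ℝ} (ht : ∀ j, 0 ≤ t j) :
    IsPotential (∑ j ∈ s, t j • K j) (fun x => ∑ j ∈ s, t j * u j x)
      (fun x => ∑ j ∈ s, t j • g j x) := by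
  classical
  induction s using Finset.induction_on with
  | empty => simpa using IsPotential.zero
  | insert a s ha ih =>
    simp only [Finset.sum_insert ha]
    exact ((hu a).smul (ht a)).add ih

/-- A linear map `L` with `⟪L w, w⟫ ≥ 0` for all `w` has non-negative determinant. -/
theorem det_nonneg_of_inner_nonneg [FiniteDimensional ℝ E] (L : E →L[ℝ] E)
    (hL : ∀ w, 0 ≤ ⟪L w, w⟫) : 0 ≤ L.det := by
  by_contra! hneg
  -- Deform the identity to `L`. If det L < 0, the determinant vanishes at some s < 1, and a kernel
  -- vector w there gives s⟪L w, w⟫ + (1 - s)|w|² = 0, although the last term is positive.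
  let F : ℝ → ℝ := fun s => (s • L + (1 - s) • ContinuousLinearMap.id ℝ E).det
  have hF : Continuous F := by
    refine ContinuousLinearMap.continuous_det.comp ?_
    fun_prop
  have h0 : F 0 = 1 := by simp [F, ContinuousLinearMap.det]
  have h1 : F 1 < 0 := by simpa [F] using hneg
  obtain ⟨s, ⟨hs0, hs1⟩, hs⟩ := intermediate_value_Icc' zero_le_one hF.continuousOn
    ⟨h1.le, by rw [h0]; exact zero_le_one⟩
  have hs1' : s < 1 := lt_of_le_of_ne hs1 fun h => by rw [h] at hs; exact h1.ne hs
  obtain ⟨w, hw, hw0⟩ := (Submodule.ne_bot_iff _).1 (LinearMap.bot_lt_ker_of_det_eq_zero hs).ne'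
  have hw' : s • L w + (1 - s) • w = 0 := by simpa using hw
  have h2 : s * ⟪L w, w⟫ + (1 - s) * ⟪w, w⟫ = 0 := by
    rw [← real_inner_smul_left, ← real_inner_smul_left, ← inner_add_left, hw', inner_zero_left]
  have h3 : 0 < ⟪w, w⟫ := real_inner_self_pos.2 hw0
  have h4 := mul_nonneg hs0 (hL w)
  have h5 := mul_pos (sub_pos.2 hs1') h3
  linarith

variable {K : ConvexBody E} {u : E → ℝ} {g : E → E}

theorem IsPotential.monotone (hu : IsPotential K u g) (x y : E) : 0 ≤ ⟪g y - g x, y - x⟫ := by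
  have h1 := hu.subgradient x y
  have h2 := hu.subgradient y x
  rw [← neg_sub y x, inner_neg_right] at h2
  rw [inner_sub_left]
  linarith

theorem IsPotential.hasFDerivAt_grad (hu : IsPotential K u g) (x : E) :
    HasFDerivAt g (fderiv ℝ g x) x :=
  (hu.contDiff.differentiable one_ne_zero x).hasFDerivAt

theorem IsPotential.inner_fderiv_nonneg (hu : IsPotential K u g) (x w : E) :
    0 ≤ ⟪fderiv ℝ g x w, w⟫ := by
  have h1 : HasDerivAt (fun s : ℝ => ⟪g (x + s • w), w⟫) ⟪fderiv ℝ g x w, w⟫ 0 := by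
    have hl : HasDerivAt (fun s : ℝ => x + s • w) w 0 := by
      simpa using ((hasDerivAt_id (0 : ℝ)).smul_const w).const_add x
    have h2 : HasFDerivAt g (fderiv ℝ g x) (x + (0 : ℝ) • w) := by
      simpa using hu.hasFDerivAt_grad x
    have h3 := (h2.comp_hasDerivAt (0 : ℝ) hl).inner ℝ (hasDerivAt_const (0 : ℝ) w)
    simpa using h3
  have hmono : Monotone (fun s : ℝ => ⟪g (x + s • w), w⟫) := by
    intro s t hst
    rcases hst.eq_or_lt with rfl | hst
    · rfl
    have h4 := hu.monotone (x + s • w) (x + t • w)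
    rw [add_sub_add_left_eq_sub, ← sub_smul, real_inner_smul_right, inner_sub_left] at h4
    have h5 := nonneg_of_mul_nonneg_right h4 (sub_pos.2 hst)
    simpa using h5
  rw [← h1.deriv]
  exact hmono.deriv_nonneg

theorem IsPotential.det_nonneg [FiniteDimensional ℝ E] (hu : IsPotential K u g) (x : E) :
    0 ≤ (fderiv ℝ g x).det :=
  det_nonneg_of_inner_nonneg _ (hu.inner_fderiv_nonneg x)

/-- The gradient is injective where its derivative is non-degenerate. -/
theorem IsPotential.injOn [FiniteDimensional ℝ E] (hu : IsPotential K u g) :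
    InjOn g {x | (fderiv ℝ g x).det ≠ 0} := by
  intro x hx y _ hxy
  by_contra hne
  -- With p = g x = g y, both x and y minimize the convex function u - ⟪p, ·⟫, hence so does every
  -- point of the segment, and g = p there. Differentiating along the segment puts y - x in the
  -- kernel of the derivative at x.
  have hconst : ∀ s ∈ Icc (0 : ℝ) 1, g (x + s • (y - x)) = g x := by
    rintro s ⟨hs0, hs1⟩
    set z := x + s • (y - x) with hz
    set p := g x with hp
    have hxv : ∀ v, u x - ⟪p, x⟫ ≤ u v - ⟪p, v⟫ := fun v => by
      have := hu.subgradient x v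
      rw [inner_sub_right] at this
      linarith
    have hyv : ∀ v, u y - ⟪p, y⟫ ≤ u v - ⟪p, v⟫ := fun v => by
      have := hu.subgradient y v
      rw [inner_sub_right, ← hxy] at this
      linarith
    have hzv : ∀ v, u z - ⟪p, z⟫ ≤ u v - ⟪p, v⟫ := by
      have h1 := hu.subgradient z x
      have h2 := hu.subgradient z y
      have e1 : x - z = -(s • (y - x)) := by rw [hz]; abel
      have e2 : y - z = (1 - s) • (y - x) := by rw [hz, sub_smul, one_smul]; abel
      rw [e1, inner_neg_right, real_inner_smul_right] at h1
      rw [e2, real_inner_smul_right] at h2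
      have h3 := hxv y
      have h4 := hyv x
      have h5 : ⟪p, z⟫ = ⟪p, x⟫ + s * (⟪p, y⟫ - ⟪p, x⟫) := by
        rw [hz, inner_add_right, real_inner_smul_right, inner_sub_right]
      have h6 : u z ≤ (1 - s) * u x + s * u y := by
        nlinarith [mul_le_mul_of_nonneg_left h1 (sub_nonneg.2 hs1),
          mul_le_mul_of_nonneg_left h2 hs0]
      intro v
      have h7 := hxv v
      have h8 : u y - ⟪p, y⟫ = u x - ⟪p, x⟫ := le_antisymm h4 h3
      have h9 : s * (u y - ⟪p, y⟫) = s * (u x - ⟪p, x⟫) := by rw [h8]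
      rw [h5]
      linarith
    have hd : HasFDerivAt (fun v => u v - ⟪p, v⟫) (innerSL ℝ (g z) - innerSL ℝ p) z :=
      (hu.hasFDerivAt z).sub (innerSL ℝ p).hasFDerivAt
    have h0 := IsLocalMin.hasFDerivAt_eq_zero (Filter.Eventually.of_forall hzv) hd
    rw [← map_sub, ← norm_eq_zero, innerSL_apply_norm, norm_eq_zero, sub_eq_zero] at h0
    exact h0
  have hl : HasDerivAt (fun s : ℝ => x + s • (y - x)) (y - x) 0 := by
    simpa using ((hasDerivAt_id (0 : ℝ)).smul_const (y - x)).const_add x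
  have h2 : HasFDerivAt g (fderiv ℝ g x) (x + (0 : ℝ) • (y - x)) := by
    simpa using hu.hasFDerivAt_grad x
  have h3 := (h2.comp_hasDerivAt (0 : ℝ) hl).hasDerivWithinAt (s := Icc 0 1)
  have h4 : HasDerivWithinAt (g ∘ fun s : ℝ => x + s • (y - x)) 0 (Icc 0 1) 0 :=
    (hasDerivWithinAt_const (0 : ℝ) _ (g x)).congr (fun s hs => hconst s hs) (by simp)
  have h5 := (uniqueDiffOn_Icc (zero_lt_one (α := ℝ)) 0 (by simp)).eq_deriv _ h3 h4
  refine hx ?_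
  by_contra hdet
  have hker := LinearMap.ker_eq_bot_of_injective
    ((LinearEquiv.ofIsUnitDet (f := (fderiv ℝ g x : E →ₗ[ℝ] E)) (v := Module.finBasis ℝ E)
      (v' := Module.finBasis ℝ E) (by
        rw [LinearMap.det_toMatrix]; exact isUnit_iff_ne_zero.2 hdet)).injective)
  have : y - x ∈ LinearMap.ker (LinearEquiv.ofIsUnitDet (f := (fderiv ℝ g x : E →ₗ[ℝ] E))
      (v := Module.finBasis ℝ E) (v' := Module.finBasis ℝ E) (by
        rw [LinearMap.det_toMatrix]; exact isUnit_iff_ne_zero.2 hdet)).toLinearMap := h5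
  rw [hker, Submodule.mem_bot, sub_eq_zero] at this
  exact hne this.symm

/-- The gradient takes all values in the interior of the body. -/
theorem IsPotential.interior_subset_range [FiniteDimensional ℝ E] (hu : IsPotential K u g) :
    interior (K : Set E) ⊆ range g := by
  intro p hp
  obtain ⟨r, hr, hball⟩ := Metric.isOpen_iff.1 isOpen_interior p hp
  obtain ⟨C, hC⟩ := hu.lower
  -- A ball about p lies in `K`, so testing `lower` at p moved by r/2 in the direction of x makes u
  -- - ⟪p, ·⟫ coercive. It attains a minimum, and the gradient there is p.
  have hbound : ∀ x, r / 2 * ‖x‖ - C ≤ u x - ⟪p, x⟫ := by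
    intro x
    have hmem : p + (r / 2) • (‖x‖⁻¹ • x) ∈ K := by
      refine interior_subset (hball ?_)
      rw [Metric.mem_ball, dist_eq_norm, add_sub_cancel_left, norm_smul, norm_smul, norm_inv,
        norm_norm, Real.norm_of_nonneg (by positivity)]
      have : ‖x‖⁻¹ * ‖x‖ ≤ 1 := inv_mul_le_one
      nlinarith
    have := hC x _ hmem
    rw [inner_add_left, real_inner_smul_left, real_inner_smul_left, real_inner_self_eq_norm_sq]
      at this
    have h2 : ‖x‖⁻¹ * ‖x‖ ^ 2 = ‖x‖ := by
      rcases eq_or_ne ‖x‖ 0 with h | h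
      · simp [h]
      · field_simp
    rw [h2] at this
    linarith
  have hcont : Continuous fun x => u x - ⟪p, x⟫ := by
    have : Continuous u := continuous_iff_continuousAt.2 fun x => (hu.hasFDerivAt x).continuousAt
    fun_prop
  have hlim : Tendsto (fun x => u x - ⟪p, x⟫) (cocompact E) atTop := by
    refine tendsto_atTop_mono hbound ?_
    exact tendsto_atTop_add_const_right _ _
      ((tendsto_norm_cocompact_atTop (E := E)).const_mul_atTop (by positivity))
  obtain ⟨x, hx⟩ := hcont.exists_forall_le hlim
  have hd : HasFDerivAt (fun v => u v - ⟪p, v⟫) (innerSL ℝ (g x) - innerSL ℝ p) x :=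
    (hu.hasFDerivAt x).sub (innerSL ℝ p).hasFDerivAt
  have h0 := IsLocalMin.hasFDerivAt_eq_zero (Filter.Eventually.of_forall hx) hd
  rw [← map_sub, ← norm_eq_zero, innerSL_apply_norm, norm_eq_zero, sub_eq_zero] at h0
  exact ⟨x, h0⟩

variable [FiniteDimensional ℝ E] [MeasurableSpace E] [BorelSpace E]

/-- Change of variables for g on the set where its derivative is invertible, where g is injective.
The image of the remaining points is null by Sard, and g covers K up to its frontier, which is null
by convexity. -/
theorem IsPotential.lintegral_det (hu : IsPotential K u g) (μ : Measure E)
    [μ.IsAddHaarMeasure] :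
    ∫⁻ x, ENNReal.ofReal (fderiv ℝ g x).det ∂μ = μ K := by
  set S : Set E := {x | (fderiv ℝ g x).det ≠ 0} with hS
  have hcont : Continuous fun x => (fderiv ℝ g x).det :=
    ContinuousLinearMap.continuous_det.comp (hu.contDiff.continuous_fderiv one_ne_zero)
  have hSm : MeasurableSet S := (isOpen_ne_fun hcont continuous_const).measurableSet
  have h1 := lintegral_abs_det_fderiv_eq_addHaar_image μ hSm
    (fun x _ => (hu.hasFDerivAt_grad x).hasFDerivWithinAt) hu.injOn
  have h2 : μ (g '' Sᶜ) = 0 := addHaar_image_eq_zero_of_det_fderivWithin_eq_zero μ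
    (fun x _ => (hu.hasFDerivAt_grad x).hasFDerivWithinAt) (fun x hx => not_not.1 hx)
  have h3 : μ (g '' S) = μ K := by
    refine le_antisymm (measure_mono ?_) ?_
    · rintro _ ⟨x, _, rfl⟩
      exact hu.mem x
    · calc μ K ≤ μ (interior (K : Set E) ∪ frontier (K : Set E)) := by
            refine measure_mono ?_
            rw [← closure_eq_interior_union_frontier]
            exact subset_closure
        _ ≤ μ (interior (K : Set E)) + μ (frontier (K : Set E)) := measure_union_le _ _
        _ = μ (interior (K : Set E)) := by rw [K.convex.addHaar_frontier μ, add_zero]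
        _ ≤ μ (g '' S ∪ g '' Sᶜ) := by
            refine measure_mono ?_
            rw [← image_union, union_compl_self, image_univ]
            exact hu.interior_subset_range
        _ ≤ μ (g '' S) + μ (g '' Sᶜ) := measure_union_le _ _
        _ = μ (g '' S) := by rw [h2, add_zero]
  rw [← h3, ← h1, ← lintegral_indicator hSm]
  refine lintegral_congr fun x => ?_
  by_cases hx : x ∈ S
  · rw [indicator_of_mem hx, abs_of_nonneg (hu.det_nonneg x)]
  · rw [indicator_of_notMem hx, not_not.1 hx, ENNReal.ofReal_zero]

theorem IsPotential.integrable_det (hu : IsPotential K u g) (μ : Measure E)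
    [μ.IsAddHaarMeasure] : Integrable (fun x => (fderiv ℝ g x).det) μ := by
  have hcont : Continuous fun x => (fderiv ℝ g x).det :=
    ContinuousLinearMap.continuous_det.comp (hu.contDiff.continuous_fderiv one_ne_zero)
  refine ⟨hcont.aestronglyMeasurable, ?_⟩
  rw [hasFiniteIntegral_iff_ofReal (Filter.Eventually.of_forall hu.det_nonneg), hu.lintegral_det]
  exact K.isCompact.measure_lt_top

/-- The volume of a convex body is the integral of the Hessian determinant of a potential. -/
theorem IsPotential.integral_det (hu : IsPotential K u g) (μ : Measure E)
    [μ.IsAddHaarMeasure] : ∫ x, (fderiv ℝ g x).det ∂μ = μ.real K := by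
  rw [integral_eq_lintegral_of_nonneg_ae (Filter.Eventually.of_forall hu.det_nonneg)
    (hu.integrable_det μ).1, hu.lintegral_det, measureReal_def]

end Potential

/-! ### Support functions and their mollification -/

section Existence

variable {E : Type*} [NormedAddCommGroup E] [InnerProductSpace ℝ E]

/-- The support function of a convex body. -/
def support (K : ConvexBody E) (x : E) : ℝ :=
  sSup ((fun y => ⟪y, x⟫) '' (K : Set E))

theorem inner_le_support (K : ConvexBody E) (x : E) {y : E} (hy : y ∈ K) :
    ⟪y, x⟫ ≤ support K x :=
  le_csSup (K.isCompact.image (by fun_prop)).bddAbove ⟨y, hy, rfl⟩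

theorem exists_inner_eq_support (K : ConvexBody E) (x : E) : ∃ y ∈ K, ⟪y, x⟫ = support K x := by
  obtain ⟨y, hy, h⟩ := K.isCompact.exists_sSup_image_eq K.nonempty
    (f := fun y => ⟪y, x⟫) (by fun_prop)
  exact ⟨y, hy, h.symm⟩

theorem support_add_le (K : ConvexBody E) (x w : E) :
    support K (x + w) ≤ support K x + support K w := by
  obtain ⟨y, hy, h⟩ := exists_inner_eq_support K (x + w)
  rw [← h, inner_add_right]
  exact add_le_add (inner_le_support K x hy) (inner_le_support K w hy)

theorem support_smul (K : ConvexBody E) {t : ℝ} (ht : 0 ≤ t) (x : E) :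
    support K (t • x) = t * support K x := by
  apply le_antisymm
  · obtain ⟨y, hy, h⟩ := exists_inner_eq_support K (t • x)
    rw [← h, real_inner_smul_right]
    exact mul_le_mul_of_nonneg_left (inner_le_support K x hy) ht
  · obtain ⟨y, hy, h⟩ := exists_inner_eq_support K x
    rw [← h, ← real_inner_smul_right]
    exact inner_le_support K _ hy

theorem exists_abs_support_le (K : ConvexBody E) :
    ∃ R, ∀ x, |support K x| ≤ R * ‖x‖ := by
  obtain ⟨R, hR⟩ := K.isBounded.exists_norm_le
  refine ⟨R, fun x => ?_⟩
  obtain ⟨y, hy, h⟩ := exists_inner_eq_support K x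
  rw [← h]
  exact (abs_real_inner_le_norm y x).trans
    (mul_le_mul_of_nonneg_right (hR y hy) (norm_nonneg x))

theorem continuous_support (K : ConvexBody E) : Continuous (support K) := by
  obtain ⟨R, hR⟩ := exists_abs_support_le K
  refine (LipschitzWith.of_le_add_mul R.toNNReal fun x y => ?_).continuous
  have h1 := support_add_le K y (x - y)
  rw [add_sub_cancel] at h1
  have h2 := (le_abs_self _).trans (hR (x - y))
  rw [dist_eq_norm]
  exact h1.trans (add_le_add_right (h2.trans
    (mul_le_mul_of_nonneg_right (Real.le_coe_toNNReal R) (norm_nonneg _))) _)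

variable [FiniteDimensional ℝ E]

/-- Every convex body has a potential, obtained by mollifying its support function. -/
theorem exists_isPotential (K : ConvexBody E) : ∃ u g, IsPotential K u g := by
  let _ : MeasurableSpace E := borel E
  have : BorelSpace E := ⟨rfl⟩
  let b : ContDiffBump (0 : E) := default
  let μ : Measure E := volume
  let ρ : E → ℝ := b.normed μ
  have hρ0 : ∀ z, 0 ≤ ρ z := b.nonneg_normed
  have hρ1 : ∫ z, ρ z ∂μ = 1 := b.integral_normed
  have hρc : Continuous ρ := b.continuous_normed
  have hρs : HasCompactSupport ρ := b.hasCompactSupport_normed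
  let u : E → ℝ := convolution ρ (support K) (ContinuousLinearMap.mul ℝ ℝ) μ
  have hu : ∀ x, u x = ∫ z, ρ z * support K (x - z) ∂μ := fun x => rfl
  have hsm : ContDiff ℝ 2 u := hρs.contDiff_convolution_left (n := 2) _ b.contDiff_normed
    (continuous_support K).locallyIntegrable
  have hint : ∀ f : E → ℝ, Continuous f → Integrable (fun z => ρ z * f z) μ := fun f hf =>
    (hρc.mul hf).integrable_of_hasCompactSupport hρs.mul_right
  have hintK : ∀ x, Integrable (fun z => ρ z * support K (x - z)) μ := fun x =>
    hint _ ((continuous_support K).comp (by fun_prop))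
  -- Subadditivity of the support function, averaged against ρ. This bound on the growth of u is
  -- what later confines its gradient to K.
  have hupper : ∀ x w, u (x + w) ≤ u x + support K w := by
    intro x w
    have : support K w = ∫ z, ρ z * support K w ∂μ := by
      rw [integral_mul_const, hρ1, one_mul]
    rw [hu, hu, this, ← integral_add (hintK x) (hint _ continuous_const)]
    refine integral_mono (hintK _) ((hintK x).add (hint _ continuous_const)) fun z => ?_
    have := mul_le_mul_of_nonneg_left (support_add_le K (x - z) w) (hρ0 z)
    rw [mul_add, sub_add_eq_add_sub] at this
    exact this
  have hconv : ConvexOn ℝ univ u := by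
    refine ⟨convex_univ, fun x _ y _ s t hs ht hst => ?_⟩
    rw [hu, hu, hu, smul_eq_mul, smul_eq_mul, ← integral_const_mul, ← integral_const_mul,
      ← integral_add ((hintK x).const_mul s) ((hintK y).const_mul t)]
    refine integral_mono (hintK _) (((hintK x).const_mul s).add ((hintK y).const_mul t))
      fun z => ?_
    have h1 := support_add_le K (s • (x - z)) (t • (y - z))
    rw [support_smul K hs, support_smul K ht] at h1
    have h2 : s • (x - z) + t • (y - z) = s • x + t • y - z := by
      rw [smul_sub, smul_sub, sub_add_sub_comm, ← add_smul, hst, one_smul]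
    rw [h2] at h1
    have h3 := mul_le_mul_of_nonneg_left h1 (hρ0 z)
    simp only
    linarith
  let g : E → E := fun x => (InnerProductSpace.toDual ℝ E).symm (fderiv ℝ u x)
  have hd : ∀ x, HasFDerivAt u (innerSL ℝ (g x)) x := by
    intro x
    have : innerSL ℝ (g x) = fderiv ℝ u x := by
      ext v
      simp [g]
    rw [this]
    exact (hsm.differentiable two_ne_zero x).hasFDerivAt
  have hsub : ∀ x y, u x + ⟪g x, y - x⟫ ≤ u y := by
    intro x y
    have hl : HasDerivAt (fun s : ℝ => x + s • (y - x)) (y - x) 0 := by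
      simpa using ((hasDerivAt_id (0 : ℝ)).smul_const (y - x)).const_add x
    have h2 : HasFDerivAt u (innerSL ℝ (g x)) (x + (0 : ℝ) • (y - x)) := by simpa using hd x
    have h3 := h2.comp_hasDerivAt (0 : ℝ) hl
    have hc : ConvexOn ℝ univ (u ∘ fun s : ℝ => x + s • (y - x)) := by
      have := hconv.comp_affineMap (AffineMap.lineMap x y)
      have e : (u ∘ fun s : ℝ => x + s • (y - x)) = u ∘ AffineMap.lineMap x y := by
        ext s
        simp [AffineMap.lineMap_apply, add_comm]
      rw [e]
      simpa using this
    have h4 := hc.le_slope_of_hasDerivAt (mem_univ 0) (mem_univ 1) zero_lt_one h3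
    simp [slope_def_field] at h4
    linarith
  refine ⟨u, g, hd, ?_, hsub, ?_, ?_⟩
  · exact (InnerProductSpace.toDual ℝ E).symm.contDiff.comp
      (hsm.fderiv_right (m := 1) (by norm_num))
  · intro x
    by_contra hx
    -- A direction v separating g x from K has ⟪g x, v⟫ > h_K(v), whereas the subgradient inequality
    -- and `hupper` give ⟪g x, v⟫ ≤ u (x + v) - u x ≤ h_K(v).
    obtain ⟨f, c, hf, hc⟩ := geometric_hahn_banach_closed_point K.convex K.isClosed hx
    obtain ⟨v, rfl⟩ := (InnerProductSpace.toDual ℝ E).surjective f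
    simp only [InnerProductSpace.toDual_apply_apply] at hf hc
    have h1 := hsub x (x + v)
    have h2 := hupper x v
    obtain ⟨y, hy, h3⟩ := exists_inner_eq_support K v
    have h4 := hf y hy
    rw [add_sub_cancel_left] at h1
    rw [real_inner_comm] at hc h4
    linarith
  -- The constant comes from averaging h_K(x) ≤ h_K(x - z) + h_K(z) over z.
  · refine ⟨∫ z, ρ z * support K z ∂μ, fun x y hy => ?_⟩
    have h1 : support K x = ∫ z, ρ z * support K x ∂μ := by
      rw [integral_mul_const, hρ1, one_mul]
    have h2 : support K x ≤ u x + ∫ z, ρ z * support K z ∂μ := by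
      rw [hu, h1, ← integral_add (hintK x) (hint _ (continuous_support K))]
      refine integral_mono (hint _ continuous_const)
        ((hintK x).add (hint _ (continuous_support K))) fun z => ?_
      have := mul_le_mul_of_nonneg_left (support_add_le K (x - z) z) (hρ0 z)
      rw [mul_add, sub_add_cancel] at this
      exact this
    have h3 := inner_le_support K x hy
    linarith

end Existence

/-! ### Coefficients of polynomials from values at integer points -/

section Interpolation

/-- Weights that recover the coefficients of polynomials of degree at most `N` from the values at
`0, …, N`. -/
theorem exists_interpolation_weights (N : ℕ) : ∃ w : ℕ → Fin (N + 1) → ℝ,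
    ∀ e ≤ N, ∀ a ≤ N, ∑ k, w e k * ((k : ℕ) : ℝ) ^ a = if a = e then 1 else 0 := by
  let A : Matrix (Fin (N + 1)) (Fin (N + 1)) ℝ := Matrix.vandermonde fun k => ((k : ℕ) : ℝ)
  have hA : IsUnit A.det := by
    rw [isUnit_iff_ne_zero, Matrix.det_vandermonde_ne_zero_iff]
    intro k l h
    exact Fin.ext (Nat.cast_injective (R := ℝ) h)
  -- The weights for exponent e are row e of the inverse Vandermonde matrix; the value 0 for e > N
  -- is never used.
  refine ⟨fun e k => if h : e ≤ N then A⁻¹ ⟨e, Nat.lt_succ_of_le h⟩ k else 0, fun e he a ha => ?_⟩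
  have := congrFun (congrFun (Matrix.nonsing_inv_mul A hA) ⟨e, Nat.lt_succ_of_le he⟩)
    ⟨a, Nat.lt_succ_of_le ha⟩
  rw [Matrix.mul_apply, Matrix.one_apply] at this
  simp only [dif_pos he]
  simpa [A, Matrix.vandermonde_apply, Fin.ext_iff, eq_comm] using this

/-- Interpolation weights for polynomials of degree at most `N`. -/
def weight (N : ℕ) : ℕ → Fin (N + 1) → ℝ := (exists_interpolation_weights N).choose

theorem sum_weight (N : ℕ) {e a : ℕ} (he : e ≤ N) (ha : a ≤ N) :
    ∑ k, weight N e k * ((k : ℕ) : ℝ) ^ a = if a = e then 1 else 0 :=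
  (exists_interpolation_weights N).choose_spec e he a ha

/-- Tensor product of the one-variable rules: on each monomial the sum over the grid factors, and
the product of the Kronecker deltas selects e. All nodes are non-negative, so only values on the
orthant enter. -/
theorem coeff_eq_sum_eval {σ : Type*} [Fintype σ] [DecidableEq σ] {N : ℕ} (P : MvPolynomial σ ℝ)
    (hP : P.totalDegree ≤ N) (e : σ →₀ ℕ) (he : ∀ j, e j ≤ N) :
    P.coeff e = ∑ k : σ → Fin (N + 1), (∏ j, weight N (e j) (k j)) *
      P.eval fun j => ((k j : ℕ) : ℝ) := by
  have key : ∀ d ∈ P.support, ∑ k : σ → Fin (N + 1), (∏ j, weight N (e j) (k j)) *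
      ∏ j, ((k j : ℕ) : ℝ) ^ d j = if d = e then 1 else 0 := by
    intro d hd
    have hdN : ∀ j, d j ≤ N := fun j =>
      ((MvPolynomial.monomial_le_degreeOf j hd).trans (P.degreeOf_le_totalDegree j)).trans hP
    simp only [← Finset.prod_mul_distrib]
    rw [← Fintype.prod_sum (f := fun j k => weight N (e j) k * ((k : ℕ) : ℝ) ^ d j)]
    simp only [sum_weight N (he _) (hdN _)]
    rw [Finset.prod_ite_zero]
    simp [DFunLike.ext_iff]
  simp only [MvPolynomial.eval_eq', Finset.mul_sum]
  rw [Finset.sum_comm]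
  rw [Finset.sum_congr rfl (g := fun d => if d = e then P.coeff d else 0)]
  · rw [Finset.sum_ite_eq' P.support e]
    split_ifs with h
    · rfl
    · exact MvPolynomial.notMem_support_iff.1 h
  · intro d hd
    have := congrArg (P.coeff d * ·) (key d hd)
    simp only [Finset.mul_sum, mul_ite, mul_one, mul_zero] at this
    rw [← this]
    exact Finset.sum_congr rfl fun k _ => by ring

end Interpolation

/-! ### Minkowski's theorem on the volume polynomial -/

section Minkowski

open MvPolynomial in
/-- The determinant of a linear combination of matrices, as a polynomial in the coefficients. -/
def detPolynomial {ι m : Type*} [Fintype ι] [Fintype m] [DecidableEq m]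
    (M : ι → Matrix m m ℝ) : MvPolynomial ι ℝ :=
  Matrix.det (Matrix.of fun a b => ∑ j, C (M j a b) * X j)

theorem eval_detPolynomial {ι m : Type*} [Fintype ι] [Fintype m] [DecidableEq m]
    (M : ι → Matrix m m ℝ) (t : ι → ℝ) :
    (detPolynomial M).eval t = (∑ j, t j • M j).det := by
  rw [detPolynomial, RingHom.map_det]
  congr 1
  ext a b
  simp [Matrix.sum_apply, mul_comm]

theorem isHomogeneous_detPolynomial {ι m : Type*} [Fintype ι] [Fintype m] [DecidableEq m]
    (M : ι → Matrix m m ℝ) : (detPolynomial M).IsHomogeneous (Fintype.card m) := by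
  rw [detPolynomial, Matrix.det_apply]
  refine MvPolynomial.IsHomogeneous.sum _ _ _ fun σ _ => ?_
  have : (∏ i, Matrix.of (fun a b => ∑ j, MvPolynomial.C (M j a b) * MvPolynomial.X j)
      (σ i) i).IsHomogeneous (Fintype.card m) := by
    have := MvPolynomial.IsHomogeneous.prod (Finset.univ : Finset m)
      (fun i => ∑ j, MvPolynomial.C (M j (σ i) i) * (MvPolynomial.X j : MvPolynomial ι ℝ))
      (fun _ => 1) fun i _ => MvPolynomial.IsHomogeneous.sum _ _ _ fun j _ =>
        MvPolynomial.isHomogeneous_C_mul_X _ _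
    simpa using this
  rcases Int.units_eq_one_or (Equiv.Perm.sign σ) with h | h
  · simpa [h] using this
  · simpa [h] using this.neg

theorem eval_eq_sum_antidiag {ι : Type*} [Fintype ι] [DecidableEq ι] {d : ℕ}
    {P : MvPolynomial ι ℝ} (hP : P.IsHomogeneous d) (t : ι → ℝ) :
    P.eval t = ∑ e ∈ Finset.univ.finsuppAntidiag d, P.coeff e * ∏ j, t j ^ e j := by
  rw [MvPolynomial.eval_eq']
  refine Finset.sum_subset (fun e he => ?_) fun e _ he => ?_
  · rw [Finset.mem_finsuppAntidiag]
    refine ⟨?_, Finset.subset_univ _⟩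
    rw [← hP (MvPolynomial.mem_support_iff.1 he), Pi.one_def, ← Finsupp.degree_eq_weight_one]
    exact (Finsupp.sum_fintype e (fun _ n => n) fun _ => rfl).symm
  · rw [MvPolynomial.notMem_support_iff.1 he, zero_mul]

/-- For t ≥ 0 the combination ∑ t_j u_j is a potential of ∑ t_j K_j, so the volume is the integral
over x of a determinant polynomial in t. Its coefficients are integrated one by one. -/
theorem exists_polynomial_of_inner {E : Type*} [NormedAddCommGroup E] [InnerProductSpace ℝ E]
    [FiniteDimensional ℝ E] [MeasurableSpace E] [BorelSpace E] (μ : Measure E)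
    [μ.IsAddHaarMeasure] {ι : Type*} [Fintype ι] (K : ι → ConvexBody E) :
    ∃ P : MvPolynomial ι ℝ, P.IsHomogeneous (Module.finrank ℝ E) ∧
      ∀ t : ι → ℝ, (∀ j, 0 ≤ t j) →
        μ.real ((∑ j, t j • K j : ConvexBody E) : Set E) = P.eval t := by
  classical
  choose u g hu using fun j => exists_isPotential (K j)
  set d := Module.finrank ℝ E with hd
  let b := Module.finBasis ℝ E
  let Q : E → MvPolynomial ι ℝ := fun x =>
    detPolynomial fun j => LinearMap.toMatrix b b (fderiv ℝ (g j) x : E →ₗ[ℝ] E)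
  have hQhom : ∀ x, (Q x).IsHomogeneous d := fun x => by
    simpa using isHomogeneous_detPolynomial
      fun j => LinearMap.toMatrix b b (fderiv ℝ (g j) x : E →ₗ[ℝ] E)
  have hQ : ∀ (t : ι → ℝ) x, (Q x).eval t = (fderiv ℝ (fun x => ∑ j, t j • g j x) x).det := by
    intro t x
    have h1 : HasFDerivAt (fun x => ∑ j, t j • g j x) (∑ j, t j • fderiv ℝ (g j) x) x :=
      HasFDerivAt.fun_sum fun j _ => ((hu j).hasFDerivAt_grad x).const_smul (t j)
    rw [eval_detPolynomial, h1.fderiv, ContinuousLinearMap.det, ← LinearMap.det_toMatrix b]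
    congr 1
    rw [ContinuousLinearMap.toLinearMap_sum, map_sum]
    simp
  have hint : ∀ t : ι → ℝ, (∀ j, 0 ≤ t j) → Integrable (fun x => (Q x).eval t) μ := by
    intro t ht
    simp only [hQ]
    exact (IsPotential.sum Finset.univ hu ht).integrable_det μ
  have hval : ∀ t : ι → ℝ, (∀ j, 0 ≤ t j) →
      ∫ x, (Q x).eval t ∂μ = μ.real ((∑ j, t j • K j : ConvexBody E) : Set E) := by
    intro t ht
    simp only [hQ]
    exact (IsPotential.sum Finset.univ hu ht).integral_det μ
  -- Each coefficient is an interpolation sum of values at non-negative integer t, and those values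
  -- are integrable Hessian determinants.
  have hcoeff : ∀ e ∈ (Finset.univ : Finset ι).finsuppAntidiag d,
      Integrable (fun x => (Q x).coeff e) μ := by
    intro e he
    have hed : ∀ j, e j ≤ d := fun j => by
      rw [← (Finset.mem_finsuppAntidiag.1 he).1]
      exact Finset.single_le_sum (f := fun j => e j) (fun _ _ => Nat.zero_le _) (Finset.mem_univ j)
    have : ∀ x, (Q x).coeff e = _ := fun x =>
      coeff_eq_sum_eval (Q x) (hQhom x).totalDegree_le e hed
    simp only [this]
    exact integrable_finsetSum _ fun k _ => (hint _ fun j => Nat.cast_nonneg _).const_mul _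
  refine ⟨∑ e ∈ (Finset.univ : Finset ι).finsuppAntidiag d,
    MvPolynomial.monomial e (∫ x, (Q x).coeff e ∂μ), ?_, ?_⟩
  · refine MvPolynomial.IsHomogeneous.sum _ _ _ fun e he =>
      MvPolynomial.isHomogeneous_monomial _ ?_
    rw [← (Finset.mem_finsuppAntidiag.1 he).1]
    exact Finsupp.sum_fintype e (fun _ n => n) fun _ => rfl
  · intro t ht
    rw [← hval t ht]
    simp only [eval_eq_sum_antidiag (hQhom _)]
    rw [integral_finsetSum _ fun e he => (hcoeff e he).mul_const _, map_sum]
    refine Finset.sum_congr rfl fun e _ => ?_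
    rw [integral_mul_const, MvPolynomial.eval_monomial, Finsupp.prod_fintype _ _ (by simp)]

/-- The image of a convex body under a continuous linear map. -/
def mapBody {E F : Type*} [NormedAddCommGroup E] [NormedSpace ℝ E] [NormedAddCommGroup F]
    [NormedSpace ℝ F] (f : E →L[ℝ] F) : ConvexBody E →+ ConvexBody F where
  toFun K := ⟨f '' K, K.convex.linear_image (f : E →ₗ[ℝ] F), K.isCompact.image f.continuous,
    K.nonempty.image f⟩
  map_zero' := ConvexBody.ext (Set.image_singleton.trans (congrArg _ (map_zero f)))
  map_add' _ _ := ConvexBody.ext (Set.image_add f)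

section mapBody

variable {E F : Type*} [NormedAddCommGroup E] [NormedSpace ℝ E] [NormedAddCommGroup F]
  [NormedSpace ℝ F]

@[simp]
theorem coe_mapBody (f : E →L[ℝ] F) (K : ConvexBody E) : (mapBody f K : Set F) = f '' K := rfl

theorem mapBody_smul (f : E →L[ℝ] F) (t : ℝ) (K : ConvexBody E) :
    mapBody f (t • K) = t • mapBody f K :=
  ConvexBody.ext (image_smul_set f t (K : Set E))

end mapBody

/-- Minkowski's theorem: the volume of a Minkowski combination of convex bodies is a homogeneous
polynomial in the coefficients. -/
theorem exists_polynomial {E : Type*} [NormedAddCommGroup E] [NormedSpace ℝ E]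
    [FiniteDimensional ℝ E] [MeasurableSpace E] [BorelSpace E] (μ : Measure E)
    [μ.IsAddHaarMeasure] {ι : Type*} [Fintype ι] (K : ι → ConvexBody E) :
    ∃ P : MvPolynomial ι ℝ, P.IsHomogeneous (Module.finrank ℝ E) ∧
      ∀ t : ι → ℝ, (∀ j, 0 ≤ t j) →
        μ.real ((∑ j, t j • K j : ConvexBody E) : Set E) = P.eval t := by
  -- The result is needed on V × V, whose norm is not Euclidean. The linear isomorphism need not
  -- preserve volume, so the measure is transported along with the bodies.
  let e : E ≃L[ℝ] EuclideanSpace ℝ (Fin (Module.finrank ℝ E)) := toEuclidean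
  obtain ⟨P, hP, h⟩ := exists_polynomial_of_inner (μ.map e) fun j => mapBody (e : E →L[ℝ] _) (K j)
  rw [finrank_euclideanSpace_fin] at hP
  refine ⟨P, hP, fun t ht => ?_⟩
  rw [← h t ht]
  simp only [← mapBody_smul, ← map_sum, coe_mapBody]
  rw [measureReal_def, measureReal_def]
  have := e.toHomeomorph.toMeasurableEquiv.map_apply (μ := μ)
    (e '' ((∑ j, t j • K j : ConvexBody E) : Set E))
  congr 1
  refine Eq.trans ?_ this.symm
  congr 1
  exact (preimage_image_eq _ e.injective).symm

end Minkowski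

/-! ### Reading off coefficients from asymptotics at zero -/

section LeadingTerm

/-- A finite limit of p(s)/s^n with n > 0 forces p(0) = 0; divide by X and induct. -/
theorem coeff_eq_of_tendsto (n : ℕ) {p : Polynomial ℝ} {L : ℝ}
    (h : Tendsto (fun s => p.eval s / s ^ n) (𝓝[>] 0) (𝓝 L)) : p.coeff n = L := by
  induction n generalizing p with
  | zero =>
    have h1 : Tendsto (fun s => p.eval s / s ^ 0) (𝓝[>] 0) (𝓝 (p.eval 0)) := by
      simpa using (p.continuous.tendsto 0).mono_left nhdsWithin_le_nhds
    rw [Polynomial.coeff_zero_eq_eval_zero]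
    exact tendsto_nhds_unique h1 h
  | succ n ih =>
    have h0 : p.eval 0 = 0 := by
      have h1 : Tendsto (fun s => p.eval s) (𝓝[>] 0) (𝓝 (p.eval 0)) :=
        (p.continuous.tendsto 0).mono_left nhdsWithin_le_nhds
      have h2 : Tendsto (fun s : ℝ => s ^ (n + 1)) (𝓝[>] 0) (𝓝 0) := by
        simpa using ((continuous_pow (n + 1)).tendsto (0 : ℝ)).mono_left nhdsWithin_le_nhds
      have h3 := h.mul h2
      rw [mul_zero] at h3
      refine tendsto_nhds_unique h1 (h3.congr' ?_)
      filter_upwards [self_mem_nhdsWithin] with s hs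
      exact div_mul_cancel₀ _ (pow_pos hs _).ne'
    have hp : ∀ s, p.eval s = p.divX.eval s * s := by
      intro s
      conv_lhs => rw [← Polynomial.divX_mul_X_add p]
      rw [Polynomial.coeff_zero_eq_eval_zero, h0]
      simp
    rw [← Polynomial.coeff_divX]
    refine ih (h.congr' ?_)
    filter_upwards [self_mem_nhdsWithin] with s hs
    have hs' : s ≠ 0 := (mem_Ioi.1 hs).ne'
    rw [hp, pow_succ, mul_div_mul_right _ _ hs']

/-- Along the ray through x, the coefficient of s^n is the degree n component of Q at x. It agrees
with c T on the orthant, a product of infinite sets, hence as a polynomial. -/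
theorem coeff_eq_of_tendsto_smul {τ : Type*} [Fintype τ] {n : ℕ} {Q T : MvPolynomial τ ℝ} {c : ℝ}
    (h : ∀ x : τ → ℝ, (∀ j, 0 ≤ x j) →
      Tendsto (fun s : ℝ => Q.eval (s • x) / s ^ n) (𝓝[>] 0) (𝓝 (c * T.eval x)))
    (e : τ →₀ ℕ) (he : e.degree = n) : Q.coeff e = c * T.coeff e := by
  classical
  have hQ : MvPolynomial.homogeneousComponent n Q = MvPolynomial.C c * T := by
    refine MvPolynomial.funext_set (fun _ => Ici (0 : ℝ)) (fun _ => Ici_infinite 0) fun x hx => ?_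
    rw [map_mul, MvPolynomial.eval_C]
    let p : Polynomial ℝ := ∑ d ∈ Finset.range (Q.totalDegree + 1),
      Polynomial.C ((MvPolynomial.homogeneousComponent d Q).eval x) * Polynomial.X ^ d
    have hp : ∀ s, p.eval s = Q.eval (s • x) := by
      intro s
      conv_rhs => rw [← MvPolynomial.sum_homogeneousComponent Q]
      rw [map_sum, Polynomial.eval_finsetSum]
      refine Finset.sum_congr rfl fun d _ => ?_
      have hd := MvPolynomial.homogeneousComponent_isHomogeneous d Q
      rw [eval_eq_sum_antidiag hd, eval_eq_sum_antidiag hd, Polynomial.eval_mul,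
        Polynomial.eval_C, Polynomial.eval_pow, Polynomial.eval_X, Finset.sum_mul]
      refine Finset.sum_congr rfl fun e he => ?_
      have : s ^ d = ∏ j, s ^ e j := by
        rw [Finset.prod_pow_eq_pow_sum, ← (Finset.mem_finsuppAntidiag.1 he).1]
      simp only [Pi.smul_apply, smul_eq_mul, mul_pow, Finset.prod_mul_distrib, this]
      ring
    have hpn := coeff_eq_of_tendsto (p := p) n (by simpa only [hp] using h x fun j => hx j trivial)
    rw [← hpn]
    simp only [p, Polynomial.finsetSum_coeff, Polynomial.coeff_C_mul, Polynomial.coeff_X_pow,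
      mul_ite, mul_one, mul_zero]
    rw [Finset.sum_ite_eq]
    split_ifs with hn
    · rfl
    · rw [MvPolynomial.homogeneousComponent_eq_zero _ _ (by simpa using hn), map_zero]
  rw [← MvPolynomial.coeff_C_mul, ← hQ, MvPolynomial.coeff_homogeneousComponent, if_pos he]

end LeadingTerm

/-! ### Volume of a thickened diagonal -/

section Diagonal

variable {E : Type*} [NormedAddCommGroup E] [NormedSpace ℝ E]

/-- The convex body `Δ(K) + A × {0} + {0} × B`. -/
def diagonalSum (K A B : ConvexBody E) : ConvexBody (E × E) :=
  diagonal K + mapBody (ContinuousLinearMap.inl ℝ E E) A +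
    mapBody (ContinuousLinearMap.inr ℝ E E) B

theorem mem_diagonalSum (K A B : ConvexBody E) (x y : E) :
    (x, y) ∈ diagonalSum K A B ↔ ∃ k ∈ K, ∃ a ∈ A, ∃ b ∈ B, k + a = x ∧ k + b = y := by
  constructor
  · rintro ⟨_, ⟨_, ⟨k, hk, rfl⟩, _, ⟨a, ha, rfl⟩, rfl⟩, _, ⟨b, hb, rfl⟩, h⟩
    refine ⟨k, hk, a, ha, b, hb, ?_⟩
    simpa using h
  · rintro ⟨k, hk, a, ha, b, hb, rfl, rfl⟩
    exact ⟨_, ⟨_, ⟨k, hk, rfl⟩, _, ⟨a, ha, rfl⟩, rfl⟩, _, ⟨b, hb, rfl⟩, by simp⟩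

theorem diagonal_add_sum_eq {σ τ : Type*} [Fintype σ] [Fintype τ]
    (K : ConvexBody E) (A : σ → ConvexBody E) (B : τ → ConvexBody E) (t : σ ⊕ τ → ℝ) :
    diagonal K + ∑ j, t j • Sum.elim (fun j => mapBody (ContinuousLinearMap.inl ℝ E E) (A j))
      (fun l => mapBody (ContinuousLinearMap.inr ℝ E E) (B l)) j =
    diagonalSum K (∑ j, t (Sum.inl j) • A j) (∑ l, t (Sum.inr l) • B l) := by
  rw [diagonalSum, Fintype.sum_sum_type, map_sum, map_sum]
  simp only [Sum.elim_inl, Sum.elim_inr, mapBody_smul]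
  exact (add_assoc _ _ _).symm

variable [FiniteDimensional ℝ E] [MeasurableSpace E] [BorelSpace E] (μ : Measure E)
  [μ.IsAddHaarMeasure]

/-- The shear preserves the product measure. In the new coordinates the body is the set of all (a -
b, k + b). -/
theorem diagonalSum_eq_preimage (K A B : ConvexBody E) :
    (μ.prod μ) (diagonalSum K A B : Set (E × E)) =
      (μ.prod μ) ((fun z : E × E => (z.1 + z.2, z.2)) ⁻¹' (diagonalSum K A B : Set (E × E))) :=
  ((measurePreserving_add_prod μ μ).measure_preimage
    (diagonalSum K A B).isClosed.measurableSet.nullMeasurableSet).symm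

/-- After the shear the body lies in (A - B) × (K + B). -/
theorem measure_diagonalSum_le (K A B : ConvexBody E) :
    (μ.prod μ).real (diagonalSum K A B : Set (E × E)) ≤
      μ.real ((A + (-1 : ℝ) • B : ConvexBody E) : Set E) *
        μ.real ((K + B : ConvexBody E) : Set E) := by
  rw [← measureReal_prod_prod, measureReal_def, measureReal_def, diagonalSum_eq_preimage]
  refine ENNReal.toReal_mono ?_ (measure_mono ?_)
  · exact ((A + (-1 : ℝ) • B : ConvexBody E).isCompact.prod
      (K + B : ConvexBody E).isCompact).measure_lt_top.ne
  · rintro ⟨u, y⟩ h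
    obtain ⟨k, hk, a, ha, b, hb, h1, h2⟩ := (mem_diagonalSum K A B _ _).1 h
    refine ⟨⟨a, ha, (-1 : ℝ) • b, smul_mem_smul_set hb, ?_⟩, ⟨k, hk, b, hb, h2⟩⟩
    simp only at h1 h2 ⊢
    rw [← h2] at h1
    rw [neg_one_smul, ← sub_eq_add_neg, sub_eq_iff_eq_add]
    refine add_left_cancel (a := k) ?_
    rw [h1]
    abel

/-- After the shear, the fibre over a - b contains the translate K + b; integrate over A - B. -/
theorem le_measure_diagonalSum (K A B : ConvexBody E) :
    μ.real ((A + (-1 : ℝ) • B : ConvexBody E) : Set E) * μ.real (K : Set E) ≤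
      (μ.prod μ).real (diagonalSum K A B : Set (E × E)) := by
  rw [measureReal_def, measureReal_def, measureReal_def, ← ENNReal.toReal_mul]
  refine ENNReal.toReal_mono (diagonalSum K A B).isCompact.measure_lt_top.ne ?_
  rw [diagonalSum_eq_preimage, Measure.prod_apply
    ((diagonalSum K A B).isClosed.measurableSet.preimage (by fun_prop)), mul_comm,
    ← setLIntegral_const]
  refine (setLIntegral_mono_ae' (A + (-1 : ℝ) • B : ConvexBody E).isClosed.measurableSet
    (.of_forall ?_)).trans (setLIntegral_le_lintegral _ _)
  rintro _ ⟨a, ha, _, ⟨b, hb, rfl⟩, rfl⟩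
  rw [← measure_preimage_add_right μ (-b) (K : Set E)]
  refine measure_mono fun y hy => ?_
  refine (mem_diagonalSum K A B _ _).2 ⟨y + -b, hy, a, ha, b, hb, ?_, by abel⟩
  simp only [neg_one_smul]
  abel

/-- The volume of `Δ(K) + s (A × {0} + {0} × B)` is `s ^ n vol(K) vol(A - B)` to leading order. -/
theorem tendsto_diagonalSum (K A B : ConvexBody E) :
    Tendsto (fun s : ℝ => (μ.prod μ).real (diagonalSum K (s • A) (s • B) : Set (E × E)) /
      s ^ Module.finrank ℝ E) (𝓝[>] 0)
      (𝓝 (μ.real (K : Set E) * μ.real ((A + (-1 : ℝ) • B : ConvexBody E) : Set E))) := by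
  set v := μ.real ((A + (-1 : ℝ) • B : ConvexBody E) : Set E) with hv
  have hscale : ∀ s : ℝ, 0 < s →
      μ.real ((s • A + (-1 : ℝ) • s • B : ConvexBody E) : Set E) =
        s ^ Module.finrank ℝ E * v := by
    intro s hs
    rw [smul_comm, ← smul_add, ConvexBody.coe_smul, measureReal_def,
      Measure.addHaar_smul_of_nonneg μ hs.le, ENNReal.toReal_mul,
      ENNReal.toReal_ofReal (pow_nonneg hs.le _), hv, measureReal_def]
  -- Minkowski's theorem supplies the continuity of vol(K + s B) at s = 0 that closes the squeeze.
  obtain ⟨P, _, hP⟩ := exists_polynomial μ (fun o : Bool => cond o K B)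
  have hPs : ∀ s : ℝ, 0 ≤ s →
      μ.real ((K + s • B : ConvexBody E) : Set E) = P.eval fun o : Bool => cond o 1 s := by
    intro s hs
    rw [← hP _ (by rintro (_ | _) <;> simp [hs])]
    simp
  have hlim : Tendsto (fun s : ℝ => v * P.eval fun o : Bool => cond o 1 s) (𝓝[>] 0)
      (𝓝 (μ.real (K : Set E) * v)) := by
    have h0 : μ.real (K : Set E) = P.eval fun o : Bool => cond o 1 0 := by
      rw [← hPs 0 le_rfl]
      congr 1
      rw [ConvexBody.coe_add, ConvexBody.coe_smul, Set.zero_smul_set B.nonempty, add_zero]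
    rw [h0, mul_comm]
    refine Tendsto.const_mul _ (Tendsto.mono_left ?_ nhdsWithin_le_nhds)
    refine Continuous.tendsto (f := fun s : ℝ => P.eval fun o : Bool => cond o 1 s) ?_ 0
    refine (MvPolynomial.continuous_eval P).comp (continuous_pi ?_)
    rintro (_ | _)
    · exact continuous_id
    · exact continuous_const
  refine tendsto_of_tendsto_of_tendsto_of_le_of_le' tendsto_const_nhds hlim ?_ ?_
  · filter_upwards [self_mem_nhdsWithin] with s hs
    have hs : 0 < s := hs
    rw [le_div_iff₀ (pow_pos hs _)]
    have := le_measure_diagonalSum μ K (s • A) (s • B)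
    rw [hscale s hs] at this
    linarith
  · filter_upwards [self_mem_nhdsWithin] with s hs
    have hs : 0 < s := hs
    rw [div_le_iff₀ (pow_pos hs _)]
    have := measure_diagonalSum_le μ K (s • A) (s • B)
    rw [hscale s hs, hPs s hs.le] at this
    linarith

end Diagonal

/-! ### Squarefree coefficients under specialization and splitting of a variable -/

section Coefficients

/-- The exponent of the squarefree monomial in all variables. -/
def ones (σ : Type*) [Finite σ] : σ →₀ ℕ := Finsupp.equivFunOnFinite.symm fun _ => 1

@[simp]
theorem ones_apply {σ : Type*} [Finite σ] (j : σ) : ones σ j = 1 := rfl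

theorem degree_ones (σ : Type*) [Fintype σ] : (ones σ).degree = Fintype.card σ := by
  rw [Finsupp.degree_eq_sum]
  simp

theorem degree_option {σ : Type*} [Fintype σ] (e : Option σ →₀ ℕ) :
    e.degree = e none + e.some.degree := by
  rw [Finsupp.degree_eq_sum, Finsupp.degree_eq_sum, Fintype.sum_option]
  rfl

/-- The polynomial obtained from a polynomial in variables indexed by `Option σ` by specializing
the variable `none` to `1`. -/
def dehomogenize {σ : Type*} (Q : MvPolynomial (Option σ) ℝ) : MvPolynomial σ ℝ :=
  ∑ e ∈ Q.support, MvPolynomial.monomial e.some (Q.coeff e)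

theorem eval_dehomogenize {σ : Type*} [Fintype σ] (Q : MvPolynomial (Option σ) ℝ) (t : σ → ℝ) :
    (dehomogenize Q).eval t = Q.eval fun o => o.elim 1 t := by
  rw [dehomogenize, map_sum, MvPolynomial.eval_eq']
  refine Finset.sum_congr rfl fun e _ => ?_
  rw [MvPolynomial.eval_monomial, Finsupp.prod_fintype _ _ (by simp), Fintype.prod_option]
  simp

theorem totalDegree_dehomogenize {σ : Type*} [Fintype σ] {d : ℕ} {Q : MvPolynomial (Option σ) ℝ}
    (hQ : Q.IsHomogeneous d) : (dehomogenize Q).totalDegree ≤ d := by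
  refine MvPolynomial.totalDegree_finsetSum_le fun e he => ?_
  refine (MvPolynomial.totalDegree_monomial_le _ _).trans ?_
  have h1 : e.degree = d := by
    have := hQ (MvPolynomial.mem_support_iff.1 he)
    rwa [Pi.one_def, ← Finsupp.degree_eq_weight_one] at this
  rw [degree_option] at h1
  have h2 : e.some.degree ≤ d := by omega
  exact h2

/-- The polynomial obtained by substituting a sum of `i` new variables for the variable `none`. -/
def splitVariable {σ : Type*} [Fintype σ] (i : ℕ) (Q : MvPolynomial (Option σ) ℝ) :
    MvPolynomial (Fin i ⊕ σ) ℝ :=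
  ∑ e ∈ Q.support, MvPolynomial.C (Q.coeff e) *
    ((∑ l : Fin i, MvPolynomial.X (Sum.inl l)) ^ e none *
      ∏ j, MvPolynomial.X (Sum.inr j) ^ e (some j))

theorem eval_splitVariable {σ : Type*} [Fintype σ] (i : ℕ) (Q : MvPolynomial (Option σ) ℝ)
    (t : Fin i ⊕ σ → ℝ) :
    (splitVariable i Q).eval t =
      Q.eval fun o => o.elim (∑ l, t (Sum.inl l)) fun j => t (Sum.inr j) := by
  rw [splitVariable, map_sum, MvPolynomial.eval_eq']
  refine Finset.sum_congr rfl fun e _ => ?_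
  simp [Fintype.prod_option]

/-- The squarefree monomial needs every b j = 1; the degree condition then forces a = i, and the
multinomial coefficient of the product of i distinct variables is i!. -/
theorem coeff_ones_sum_pow_mul_prod {σ : Type*} [Fintype σ] (i : ℕ) (b : σ →₀ ℕ) (a : ℕ)
    (hab : a + b.degree = i + Fintype.card σ) :
    ((∑ l : Fin i, MvPolynomial.X (Sum.inl l)) ^ a *
      ∏ j, MvPolynomial.X (Sum.inr j) ^ b j : MvPolynomial (Fin i ⊕ σ) ℝ).coeff (ones _) =
        if b = ones σ then (i.factorial : ℝ) else 0 := by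
  classical
  have hmon : ∀ k : Fin i → ℕ, (∏ l, MvPolynomial.X (Sum.inl l) ^ k l) *
      ∏ j, MvPolynomial.X (Sum.inr j) ^ b j = MvPolynomial.monomial
        (Finsupp.equivFunOnFinite.symm (Sum.elim k b) : Fin i ⊕ σ →₀ ℕ) (1 : ℝ) := by
    intro k
    rw [MvPolynomial.monomial_eq, Finsupp.prod_fintype _ _ (by simp), Fintype.prod_sum_type]
    simp
  have hcoeff : ∀ k : Fin i → ℕ, (MvPolynomial.monomial
      (Finsupp.equivFunOnFinite.symm (Sum.elim k b) : Fin i ⊕ σ →₀ ℕ) (1 : ℝ)).coeff (ones _) =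
        if k = 1 ∧ b = ones σ then 1 else 0 := by
    intro k
    rw [MvPolynomial.coeff_monomial]
    congr 1
    rw [eq_iff_iff, DFunLike.ext_iff, DFunLike.ext_iff (f := b), Sum.forall, funext_iff]
    simp
  rw [Finset.sum_pow_eq_sum_piAntidiag, Finset.sum_mul, MvPolynomial.coeff_sum]
  simp only [mul_assoc, hmon]
  simp only [← map_natCast (MvPolynomial.C (σ := Fin i ⊕ σ) (R := ℝ)), MvPolynomial.coeff_C_mul,
    hcoeff]
  by_cases hb : b = ones σ
  · have ha : a = i := by
      rw [hb, degree_ones] at hab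
      omega
    subst ha
    simp only [hb, and_true, if_true, mul_ite, mul_one, mul_zero]
    rw [Finset.sum_ite_eq', if_pos]
    · simp [Nat.multinomial]
    · simp
  · simp [hb]

theorem coeff_splitVariable {σ : Type*} [Fintype σ] {i : ℕ} {Q : MvPolynomial (Option σ) ℝ}
    (hQ : Q.IsHomogeneous (i + Fintype.card σ)) :
    (splitVariable i Q).coeff (ones _) = i.factorial * (dehomogenize Q).coeff (ones σ) := by
  classical
  rw [splitVariable, dehomogenize, MvPolynomial.coeff_sum, MvPolynomial.coeff_sum, Finset.mul_sum]
  refine Finset.sum_congr rfl fun e he => ?_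
  have h1 : e.degree = i + Fintype.card σ := by
    have := hQ (MvPolynomial.mem_support_iff.1 he)
    rwa [Pi.one_def, ← Finsupp.degree_eq_weight_one] at this
  rw [degree_option] at h1
  have := coeff_ones_sum_pow_mul_prod i e.some (e none) h1
  simp only [Finsupp.some_apply] at this
  rw [MvPolynomial.coeff_C_mul, this, MvPolynomial.coeff_monomial]
  split_ifs <;> ring

end Coefficients

/-! ### Mixed volumes with a repeated body -/

section MixedVolume

theorem sum_smul_eq {E : Type*} [NormedAddCommGroup E] [NormedSpace ℝ E] {α : Type*}
    (s : Finset α) {t : α → ℝ} (ht : ∀ l, 0 ≤ t l) (K : ConvexBody E) :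
    ∑ l ∈ s, t l • K = (∑ l ∈ s, t l) • K := by
  classical
  induction s using Finset.induction_on with
  | empty =>
    refine ConvexBody.ext ?_
    simpa using (Set.zero_smul_set K.nonempty).symm
  | insert a s ha ih =>
    rw [Finset.sum_insert ha, Finset.sum_insert ha, ih]
    exact ConvexBody.ext (K.convex.add_smul (ht a) (Finset.sum_nonneg fun l _ => ht l)).symm

/-- The volume of `K + ∑ λ_j A_j` is a polynomial in the `λ_j`. -/
theorem exists_polynomial_add {E : Type*} [NormedAddCommGroup E] [NormedSpace ℝ E]
    [FiniteDimensional ℝ E] [MeasurableSpace E] [BorelSpace E] (μ : Measure E)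
    [μ.IsAddHaarMeasure] {σ : Type*} [Fintype σ] (K : ConvexBody E) (A : σ → ConvexBody E) :
    ∃ R : MvPolynomial σ ℝ, R.totalDegree ≤ Module.finrank ℝ E ∧
      ∀ t : σ → ℝ, (∀ j, 0 ≤ t j) →
        μ.real ((K + ∑ j, t j • A j : ConvexBody E) : Set E) = R.eval t := by
  obtain ⟨Q, hQ, h⟩ := exists_polynomial μ fun o : Option σ => o.elim K A
  refine ⟨dehomogenize Q, totalDegree_dehomogenize hQ, fun t ht => ?_⟩
  rw [eval_dehomogenize, ← h _ (by rintro (_ | j) <;> simp [ht]), Fintype.sum_option]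
  simp

/-- The mixed volume `V(K[i], A₁, …, A_m)` is, up to a factor, the coefficient of `λ₁ ⋯ λ_m` in the
volume of `K + ∑ λ_j A_j`. -/
theorem factorial_mul_mixedVolume_eq {E : Type*} [NormedAddCommGroup E] [InnerProductSpace ℝ E]
    [FiniteDimensional ℝ E] [MeasurableSpace E] [BorelSpace E] {σ : Type*} [Fintype σ] {i : ℕ}
    (hi : Module.finrank ℝ E = i + Fintype.card σ) (K : ConvexBody E) (A : σ → ConvexBody E)
    {R : MvPolynomial σ ℝ} (hR : ∀ t : σ → ℝ, (∀ j, 0 ≤ t j) →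
      volume.real ((K + ∑ j, t j • A j : ConvexBody E) : Set E) = R.eval t) :
    ((Module.finrank ℝ E).factorial : ℝ) * mixedVolume (Sum.elim (fun _ : Fin i => K) A) =
      i.factorial * R.coeff (ones σ) := by
  obtain ⟨Q, hQ, h⟩ := exists_polynomial volume fun o : Option σ => o.elim K A
  have hcard : Fintype.card (Fin i ⊕ σ) = Module.finrank ℝ E := by simp [hi]
  -- Convexity gives ∑ t_l K = (∑ t_l) K, so repeating K amounts to splitting its variable into a
  -- sum of i variables. This produces the factor i!.
  have h1 := factorial_mul_mixedVolume_eq_coeff hcard (Sum.elim (fun _ : Fin i => K) A)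
    (splitVariable i Q) fun t ht => by
      rw [eval_splitVariable, ← h _ (by
        rintro (_ | j)
        · exact Finset.sum_nonneg fun l _ => ht _
        · exact ht _), Fintype.sum_option, Fintype.sum_sum_type]
      simp only [Sum.elim_inl, Sum.elim_inr, Option.elim]
      rw [sum_smul_eq _ fun l => ht _]
  rw [hcard] at h1
  have h2 : dehomogenize Q = R := by
    refine MvPolynomial.funext_set (fun _ => Ici (0 : ℝ)) (fun _ => Ici_infinite 0) fun t ht => ?_
    have ht' : ∀ j, 0 ≤ t j := fun j => ht j (mem_univ j)
    rw [← hR t ht', eval_dehomogenize, ← h _ (by rintro (_ | j) <;> simp [ht']),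
      Fintype.sum_option]
    simp
  rw [h1, ← h2, ← coeff_splitVariable (hi ▸ hQ)]
  rfl

end MixedVolume

/-! ### Representations by volume valuations and their product -/

section Representation

variable {V : Type*} [NormedAddCommGroup V] [InnerProductSpace ℝ V] [FiniteDimensional ℝ V]

/-- An isometry of a Euclidean space with a standard one. -/
def coordinates (V : Type*) [NormedAddCommGroup V] [InnerProductSpace ℝ V]
    [FiniteDimensional ℝ V] : V ≃ₗᵢ[ℝ] EuclideanSpace ℝ (Fin (Module.finrank ℝ V)) :=
  (stdOrthonormalBasis ℝ V).repr

/-- The valuation `K ↦ vol(K + A)`. -/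
def volumeGenerator (A : ConvexBody V) : Generator V where
  dim := Module.finrank ℝ V
  emb := (coordinates V).toLinearEquiv
  emb_injective := (coordinates V).injective
  body := mapBody ((coordinates V).toContinuousLinearEquiv : V →L[ℝ] _) A
  density := fun _ => 1
  density_smooth := contDiff_const

variable [MeasurableSpace V] [BorelSpace V]

theorem measure_image_coordinates (s : Set V) :
    volume (coordinates V '' s) = volume s := by
  have h := (coordinates V).measurePreserving.measure_preimage_emb
    (coordinates V).toHomeomorph.measurableEmbedding (coordinates V '' s)
  rw [← h, preimage_image_eq _ (coordinates V).injective]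

theorem measure_image_coordinates_prod (s : Set (V × V)) :
    (volume.prod volume) (Prod.map (coordinates V) (coordinates V) '' s) =
      (volume.prod volume) s := by
  have hmp := (coordinates V).measurePreserving.prod (coordinates V).measurePreserving
  have h := hmp.measure_preimage_emb
    ((coordinates V).toHomeomorph.prodCongr (coordinates V).toHomeomorph).measurableEmbedding
    (Prod.map (coordinates V) (coordinates V) '' s)
  rw [← h]
  congr 1
  exact preimage_image_eq _ ((coordinates V).injective.prodMap (coordinates V).injective)

theorem toValuation_volumeGenerator (A K : ConvexBody V) :
    (volumeGenerator A).toValuation K = volume.real ((K + A : ConvexBody V) : Set V) := by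
  have : (volumeGenerator A).emb '' (K : Set V) + ((volumeGenerator A).body : Set _) =
      coordinates V '' ((K + A : ConvexBody V) : Set V) :=
    (Set.image_add (coordinates V)).symm
  refine (congrArg (fun s : Set (EuclideanSpace ℝ (Fin (Module.finrank ℝ V))) =>
    ∫ _ in s, (1 : ℂ)) this).trans ?_
  rw [setIntegral_const, measureReal_def, measure_image_coordinates, measureReal_def]
  simp

/-- The region of integration is the image of the thickened diagonal under the coordinate isometry
in each factor, which preserves the product measure. -/
theorem exterior_volumeGenerator (A B K : ConvexBody V) :
    (volumeGenerator A).exterior (volumeGenerator B) (diagonal K) =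
      (volume.prod volume).real (diagonalSum K A B : Set (V × V)) := by
  have : Prod.map (volumeGenerator A).emb (volumeGenerator B).emb '' (diagonal K : Set (V × V)) +
      ((volumeGenerator A).body : Set _) ×ˢ {0} + {0} ×ˢ ((volumeGenerator B).body : Set _) =
      Prod.map (coordinates V) (coordinates V) '' (diagonalSum K A B : Set (V × V)) := by
    ext ⟨x, y⟩
    refine ((volumeGenerator A).mem_region (volumeGenerator B) _ x y).trans ?_
    constructor
    · rintro ⟨_, _, ⟨k, hk, h⟩, ⟨a, ha, hx⟩, ⟨b, hb, hy⟩⟩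
      obtain ⟨h1, h2⟩ := Prod.mk.inj h
      rw [← h1] at hx
      rw [← h2] at hy
      refine ⟨(k + a, k + b), (mem_diagonalSum K A B _ _).2 ⟨k, hk, a, ha, b, hb, rfl, rfl⟩, ?_⟩
      refine Prod.ext ?_ ?_
      · exact (map_add (coordinates V) k a).trans (add_eq_of_eq_sub' hx)
      · exact (map_add (coordinates V) k b).trans (add_eq_of_eq_sub' hy)
    · rintro ⟨⟨x', y'⟩, h, he⟩
      cases he
      obtain ⟨k, hk, a, ha, b, hb, rfl, rfl⟩ := (mem_diagonalSum K A B _ _).1 h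
      refine ⟨k, k, ⟨k, hk, rfl⟩, ⟨a, ha, ?_⟩, ⟨b, hb, ?_⟩⟩
      · exact eq_sub_of_add_eq' (map_add (coordinates V) k a).symm
      · exact eq_sub_of_add_eq' (map_add (coordinates V) k b).symm
  refine (congrArg (fun s : Set (EuclideanSpace ℝ (Fin (Module.finrank ℝ V)) ×
    EuclideanSpace ℝ (Fin (Module.finrank ℝ V))) =>
      ∫ _ in s, (1 : ℂ) * 1 ∂(volume.prod volume)) this).trans ?_
  rw [setIntegral_const, measureReal_def, measure_image_coordinates_prod, measureReal_def]
  simp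

variable {σ τ : Type*} [Fintype σ] [Fintype τ]

/-- The squarefree monomial has degree n, exactly the order of the leading term vol(K) vol(A - B) of
Q along rays, and vol(A - B) is itself the volume polynomial of the family A_j, -B_l. -/
theorem coeff_ones_diagonalSum (K : ConvexBody V) (A : σ → ConvexBody V) (B : τ → ConvexBody V)
    (hcard : Fintype.card (σ ⊕ τ) = Module.finrank ℝ V) {Q : MvPolynomial (σ ⊕ τ) ℝ}
    (hQ : ∀ t : σ ⊕ τ → ℝ, (∀ j, 0 ≤ t j) → (volume.prod volume).real
      (diagonalSum K (∑ j, t (Sum.inl j) • A j) (∑ l, t (Sum.inr l) • B l) : Set (V × V)) =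
        Q.eval t) :
    Q.coeff (ones _) = volume.real (K : Set V) * ((Module.finrank ℝ V).factorial *
      mixedVolume (Sum.elim A fun l => (-1 : ℝ) • B l)) := by
  obtain ⟨T, _, hT⟩ := exists_polynomial (volume : Measure V) (Sum.elim A fun l => (-1 : ℝ) • B l)
  have h1 := factorial_mul_mixedVolume_eq_coeff hcard _ T hT
  rw [← hcard, h1]
  refine coeff_eq_of_tendsto_smul (n := Module.finrank ℝ V) (fun x hx => ?_) _
    ((degree_ones _).trans hcard)
  have h2 := tendsto_diagonalSum (volume : Measure V) K (∑ j, x (Sum.inl j) • A j)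
    (∑ l, x (Sum.inr l) • B l)
  have h3 : ∑ j, x (Sum.inl j) • A j + (-1 : ℝ) • ∑ l, x (Sum.inr l) • B l =
      ∑ j, x j • Sum.elim A (fun l => (-1 : ℝ) • B l) j := by
    rw [Fintype.sum_sum_type, Finset.smul_sum]
    simp only [Sum.elim_inl, Sum.elim_inr]
    congr 1
    exact Finset.sum_congr rfl fun l _ => smul_comm _ _ _
  rw [h3, hT x hx] at h2
  refine h2.congr' ?_
  filter_upwards [self_mem_nhdsWithin] with s hs
  rw [← hQ (s • x) fun j => mul_nonneg (mem_Ioi.1 hs).le (hx j), Finset.smul_sum, Finset.smul_sum]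
  simp only [smul_smul, Pi.smul_apply, smul_eq_mul]

variable [DecidableEq σ] [DecidableEq τ]

/-- The Minkowski combination of the `A_j` with natural coefficients. -/
def natCombination {N : ℕ} (A : σ → ConvexBody V) (k : σ → Fin N) : ConvexBody V :=
  ∑ j, ((k j : ℕ) : ℝ) • A j

/-- The weights that extract the squarefree coefficient of a polynomial of degree at most `N`. -/
def onesWeight (N : ℕ) (k : σ → Fin (N + 1)) : ℝ := ∏ j, weight N 1 (k j)

theorem coeff_ones_eq_sum {N : ℕ} (hN : 1 ≤ N) (P : MvPolynomial σ ℝ) (hP : P.totalDegree ≤ N) :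
    P.coeff (ones σ) = ∑ k : σ → Fin (N + 1), onesWeight N k * P.eval fun j => ((k j : ℕ) : ℝ) :=
  coeff_eq_sum_eval P hP (ones σ) fun _ => hN

/-- A representation of `K ↦ V(K[i], A₁, …, A_m)` as a combination of valuations
`K ↦ vol(K + A)`. -/
def mixedVolumeRepresentation (N i : ℕ) (A : σ → ConvexBody V) : Generator V →₀ ℂ :=
  ∑ k : σ → Fin (N + 1), Finsupp.single (volumeGenerator (natCombination A k))
    (((i.factorial : ℝ) / (Module.finrank ℝ V).factorial * onesWeight N k : ℝ) : ℂ)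

theorem combination_mixedVolumeRepresentation {N i : ℕ} (hN : 1 ≤ N)
    (hN' : Module.finrank ℝ V ≤ N) (A : σ → ConvexBody V)
    (hi : Module.finrank ℝ V = i + Fintype.card σ) (K : ConvexBody V) :
    combination (mixedVolumeRepresentation N i A) K =
      mixedVolume (Sum.elim (fun _ : Fin i => K) A) := by
  obtain ⟨R, hdeg, hR⟩ := exists_polynomial_add (volume : Measure V) K A
  have h1 := factorial_mul_mixedVolume_eq hi K A hR
  rw [coeff_ones_eq_sum hN R (hdeg.trans hN')] at h1
  have h2 : mixedVolume (Sum.elim (fun _ : Fin i => K) A) =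
      ∑ k : σ → Fin (N + 1), (i.factorial : ℝ) / (Module.finrank ℝ V).factorial *
        onesWeight N k * volume.real ((K + natCombination A k : ConvexBody V) : Set V) := by
    have hf : ((Module.finrank ℝ V).factorial : ℝ) ≠ 0 := by positivity
    rw [← mul_right_inj' hf, h1, Finset.mul_sum, Finset.mul_sum]
    refine Finset.sum_congr rfl fun k _ => ?_
    rw [natCombination, hR _ fun j => Nat.cast_nonneg _]
    field_simp
  rw [h2, combination, mixedVolumeRepresentation,
    ← Finsupp.sum_finsetSum_index (fun _ => zero_mul _) (fun _ _ _ => add_mul _ _ _),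
    Complex.ofReal_sum]
  refine Finset.sum_congr rfl fun k _ => ?_
  rw [Finsupp.sum_single_index (zero_mul _), toValuation_volumeGenerator]
  push_cast
  ring

/-- The double sum is a single interpolation sum for the volume polynomial on V × V. Its degree can
reach 2n, whence the bound on N, and both factors use the same N so that their weights combine. -/
theorem combinationExterior_mixedVolumeRepresentation {N i i' : ℕ} (hN : 1 ≤ N)
    (hN' : 2 * Module.finrank ℝ V ≤ N) (A : σ → ConvexBody V) (B : τ → ConvexBody V)
    (hcard : Fintype.card (σ ⊕ τ) = Module.finrank ℝ V) (K : ConvexBody V) :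
    combinationExterior (mixedVolumeRepresentation N i A) (mixedVolumeRepresentation N i' B)
      (diagonal K) = ((i.factorial * i'.factorial / (Module.finrank ℝ V).factorial *
        mixedVolume (Sum.elim A fun l => (-1 : ℝ) • B l) * volume.real (K : Set V) : ℝ) : ℂ) := by
  obtain ⟨Q, hdeg, hQ⟩ := exists_polynomial_add ((volume : Measure V).prod (volume : Measure V))
    (diagonal K) (Sum.elim (fun j => mapBody (ContinuousLinearMap.inl ℝ V V) (A j))
      (fun l => mapBody (ContinuousLinearMap.inr ℝ V V) (B l)))
  simp only [diagonal_add_sum_eq] at hQ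
  rw [Module.finrank_prod, ← two_mul] at hdeg
  have h1 := coeff_ones_diagonalSum K A B hcard hQ
  rw [coeff_ones_eq_sum hN Q (hdeg.trans hN')] at h1
  -- A grid point over `σ ⊕ τ` is a pair of grid points, and its weight is the product of theirs.
  have h2 : ∑ k : σ ⊕ τ → Fin (N + 1), onesWeight N k * Q.eval (fun j => ((k j : ℕ) : ℝ)) =
      ∑ k : σ → Fin (N + 1), ∑ l : τ → Fin (N + 1), onesWeight N k * onesWeight N l *
        (volume.prod volume).real
          (diagonalSum K (natCombination A k) (natCombination B l) : Set (V × V)) := by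
    rw [← (Equiv.sumArrowEquivProdArrow σ τ (Fin (N + 1))).symm.sum_comp, Fintype.sum_prod_type]
    refine Finset.sum_congr rfl fun k _ => Finset.sum_congr rfl fun l _ => ?_
    rw [← hQ _ fun j => Nat.cast_nonneg _, onesWeight, Fintype.prod_sum_type]
    rfl
  have h3 : i.factorial * i'.factorial / (Module.finrank ℝ V).factorial *
        mixedVolume (Sum.elim A fun l => (-1 : ℝ) • B l) * volume.real (K : Set V) =
      ∑ k : σ → Fin (N + 1), ∑ l : τ → Fin (N + 1),
        ((i.factorial : ℝ) / (Module.finrank ℝ V).factorial * onesWeight N k) *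
        ((i'.factorial : ℝ) / (Module.finrank ℝ V).factorial * onesWeight N l) *
        (volume.prod volume).real
          (diagonalSum K (natCombination A k) (natCombination B l) : Set (V × V)) := by
    have hf : ((Module.finrank ℝ V).factorial : ℝ) ≠ 0 := by positivity
    calc _ = (i.factorial : ℝ) / (Module.finrank ℝ V).factorial *
          ((i'.factorial : ℝ) / (Module.finrank ℝ V).factorial) *
          (volume.real (K : Set V) * ((Module.finrank ℝ V).factorial *
            mixedVolume (Sum.elim A fun l => (-1 : ℝ) • B l))) := by
          field_simp
      _ = _ := by
          rw [← h1, h2]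
          simp only [Finset.mul_sum]
          exact Finset.sum_congr rfl fun k _ => Finset.sum_congr rfl fun l _ => by ring
  rw [h3, combinationExterior]
  conv_lhs => rw [mixedVolumeRepresentation]
  rw [← Finsupp.sum_finsetSum_index (fun _ => by simp)
    (fun _ _ _ => by simp [add_mul, Finsupp.sum_add]), Complex.ofReal_sum]
  refine Finset.sum_congr rfl fun k _ => ?_
  rw [Finsupp.sum_single_index (by simp)]
  conv_lhs => rw [mixedVolumeRepresentation]
  rw [← Finsupp.sum_finsetSum_index (fun _ => by simp) (fun _ _ _ => by ring), Complex.ofReal_sum]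
  refine Finset.sum_congr rfl fun l _ => ?_
  rw [Finsupp.sum_single_index (by simp), exterior_volumeGenerator]
  push_cast
  ring

end Representation

end AleskerProduct

end

/-! ### The product formula -/

theorem proposition2p2 {V : Type*} [NormedAddCommGroup V] [InnerProductSpace ℝ V]
    [FiniteDimensional ℝ V] [MeasurableSpace V] [BorelSpace V]
    (n i : ℕ) (hn : Module.finrank ℝ V = n) (hi : i ≤ n)
    (A : Fin (n - i) → ConvexBody V) (B : Fin i → ConvexBody V)
    (φ ψ : ConvexBody V → ℂ)
    (hφ : ∀ K, φ K = AleskerProduct.mixedVolume (Sum.elim (fun _ : Fin i => K) A))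
    (hψ : ∀ K, ψ K = AleskerProduct.mixedVolume (Sum.elim (fun _ : Fin (n - i) => K) B)) :
    ∃ (hφG : φ ∈ AleskerProduct.GVal V) (hψG : ψ ∈ AleskerProduct.GVal V),
      ∀ K : ConvexBody V,
        AleskerProduct.product ⟨φ, hφG⟩ ⟨ψ, hψG⟩ K =
          (n.choose i : ℂ)⁻¹ *
            AleskerProduct.mixedVolume (Sum.elim A fun l => (-1 : ℝ) • B l) *
            MeasureTheory.volume.real (K : Set V) := by
  -- The value N = 2n + 1 dominates the degree 2n on V × V and stays at least 1, the exponent to be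
  -- extracted, when n = 0.
  have hc : AleskerProduct.combination
      (AleskerProduct.mixedVolumeRepresentation (2 * n + 1) i A) = φ := by
    ext K
    rw [hφ, AleskerProduct.combination_mixedVolumeRepresentation (by omega) (by omega) A
      (by rw [Fintype.card_fin]; omega)]
  have hd : AleskerProduct.combination
      (AleskerProduct.mixedVolumeRepresentation (2 * n + 1) (n - i) B) = ψ := by
    ext K
    rw [hψ, AleskerProduct.combination_mixedVolumeRepresentation (by omega) (by omega) B
      (by rw [Fintype.card_fin]; omega)]
  refine ⟨⟨_, hc⟩, ⟨_, hd⟩, fun K => ?_⟩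
  rw [AleskerProduct.product, AleskerProduct.exteriorProduct_eq _ _ _ _ hc hd,
    AleskerProduct.combinationExterior_mixedVolumeRepresentation (by omega) (by omega) A B
      (by simp; omega), hn]
  have h : (n.choose i : ℂ)⁻¹ = (i.factorial * (n - i).factorial : ℂ) / n.factorial := by
    rw [← Nat.choose_mul_factorial_mul_factorial hi]
    have h1 : (n.choose i : ℂ) ≠ 0 := Nat.cast_ne_zero.2 (Nat.choose_pos hi).ne'
    have h2 : (i.factorial : ℂ) ≠ 0 := Nat.cast_ne_zero.2 i.factorial_ne_zero
    have h3 : ((n - i).factorial : ℂ) ≠ 0 := Nat.cast_ne_zero.2 (n - i).factorial_ne_zero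
    push_cast
    field_simp
  rw [h]
  push_cast
  ring
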